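/- Let $\mathbb K=\mathbb R$ or $\mathbb C$. A finite-valued convex modular on a $\mathbb K$-vector space $X$ is a convex function $\Theta:X\to[0,\infty)$ with $\Theta(0)=0$, $\Theta(\lambda x)=\Theta(x)$ for $|\lambda|=1$, and $\Theta(x)=0\Rightarrow x=0$; its Luxemburg norm is $\|x\|=\inf\{\lambda>0:\Theta(x/\lambda)\le 1\}$. For a bounded family of exponents $p_i\in[1,\infty)$, $i\in I$, the Nakano space $\ell_{(p_i)}$ is the space of all $x\in\mathbb K^I$ with $\Theta(x)=\sum_i|x(i)|^{p_i}<\infty$, with the Luxemburg norm of $\Theta$. A Hilbert space carries the modular $\|h\|^2$. The modular direct sum $X_1\oplus_m X_2$ is $X_1\oplus X_2$ with the Luxemburg norm of the modular $\Theta_1(x_1)+\Theta_2(x_2)$. Two Banach spaces are elementarily equivalent if some ultrapower of one is linearly isometric to some ultrapower of the other; the elementary class of a Banach space is the class of all Banach spaces that are elementarily equivalent to it. Let $(p_n)_{n\in\mathbb N}$ be a sequence in $[1,\infty)$ with $p_n\to 2$, let $N=\ell_{(p_n)}$, and let $N_{nh}$ be the Nakano space associated to the (infinite, finite or empty) family of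 those $p_n$ that differ from $2$. Then, up to linear isometry, the elementary class of $N$ consists of: - all modular direct sums $N_{nh}\oplus_m H$ with $H$ an arbitrary Hilbert space (possibly finite dimensional or zero), if $p_n\ne 2$ for infinitely many $n$; - all modular direct sums $N_{nh}\oplus_m H$ with $H$ an infinite dimensional Hilbert space, if $p_n\ne 2$ for only finitely many $n$. In both cases this class is uncountably categorical: it is closed under ultrapowers and under ultraroots (a Banach space some ultrapower of which is linearly isometric to a member of the class is in the class), and for every uncountable cardinal $\kappa$ it contains, up to linear isometry, exactly one space of density character $\kappa$. -/

import Mathlib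

open Filter Topology
open scoped ENNReal

universe u v w

noncomputable section

/-! ### Convex modulars and the Luxemburg norm -/

/-- A (finite valued) convex modular on a vector space over `𝕜 = ℝ` or `ℂ`: a convex function
`Θ : X → ℝ₊` with `Θ 0 = 0`, which is symmetric and faithful. -/
structure ConvexModular (𝕜 : Type u) [RCLike 𝕜] (X : Type v) [AddCommGroup X] [Module 𝕜 X] where
  toFun : X → ℝ
  nonneg' : ∀ x, 0 ≤ toFun x
  map_zero' : toFun 0 = 0
  convex' : ∀ (x y : X) (a b : ℝ), 0 ≤ a → 0 ≤ b → a + b = 1 →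
    toFun ((a : 𝕜) • x + (b : 𝕜) • y) ≤ a * toFun x + b * toFun y
  symm' : ∀ (c : 𝕜) (x : X), ‖c‖ = 1 → toFun (c • x) = toFun x
  faithful' : ∀ x, toFun x = 0 → x = 0

namespace ConvexModular

instance {𝕜 : Type u} [RCLike 𝕜] {X : Type v} [AddCommGroup X] [Module 𝕜 X] :
    CoeFun (ConvexModular 𝕜 X) (fun _ => X → ℝ) := ⟨toFun⟩

section Basic

variable {𝕜 : Type u} [RCLike 𝕜] {X : Type v} [AddCommGroup X] [Module 𝕜 X]
  (Θ : ConvexModular 𝕜 X)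

theorem smul_le (x : X) {a : ℝ} (h0 : 0 ≤ a) (h1 : a ≤ 1) : Θ ((a : 𝕜) • x) ≤ a * Θ x := by
  have h := Θ.convex' x 0 a (1 - a) h0 (by linarith) (by ring)
  simpa [Θ.map_zero'] using h

/-- The set whose infimum is the Luxemburg norm. -/
def luxSet (x : X) : Set ℝ := {r : ℝ | 0 < r ∧ Θ (((r⁻¹ : ℝ) : 𝕜) • x) ≤ 1}

/-- The Luxemburg norm `inf {r > 0 : Θ (x / r) ≤ 1}`. -/
def luxNorm (x : X) : ℝ := sInf (Θ.luxSet x)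

theorem luxSet_bddBelow (x : X) : BddBelow (Θ.luxSet x) := ⟨0, fun _ h => h.1.le⟩

theorem luxSet_nonempty (x : X) : (Θ.luxSet x).Nonempty := by
  have hx := Θ.nonneg' x
  have hpos : 0 < Θ x + 1 := by linarith
  refine ⟨Θ x + 1, hpos, (Θ.smul_le x (inv_nonneg.2 hpos.le)
    (inv_le_one_of_one_le₀ (by linarith))).trans ?_⟩
  rw [inv_mul_le_iff₀ hpos]
  linarith

theorem luxNorm_nonneg (x : X) : 0 ≤ Θ.luxNorm x := Real.sInf_nonneg fun _ h => h.1.le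

theorem mem_luxSet_of_lt {x : X} {r : ℝ} (h : Θ.luxNorm x < r) : r ∈ Θ.luxSet x := by
  obtain ⟨s, ⟨hs, hs1⟩, hsr⟩ := exists_lt_of_csInf_lt (Θ.luxSet_nonempty x) h
  have hr : 0 < r := hs.trans hsr
  refine ⟨hr, ?_⟩
  have h1 := Θ.smul_le (((s⁻¹ : ℝ) : 𝕜) • x) (a := s / r) (by positivity)
    ((div_le_one hr).2 hsr.le)
  rw [smul_smul, ← RCLike.ofReal_mul] at h1
  have h2 : s / r * s⁻¹ = r⁻¹ := by field_simp
  rw [h2] at h1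
  refine h1.trans ?_
  have h3 : s / r ≤ 1 := (div_le_one hr).2 hsr.le
  have h4 : 0 ≤ s / r := by positivity
  nlinarith [Θ.nonneg' (((s⁻¹ : ℝ) : 𝕜) • x)]

theorem luxNorm_add_le (x y : X) : Θ.luxNorm (x + y) ≤ Θ.luxNorm x + Θ.luxNorm y := by
  refine le_of_forall_pos_lt_add fun ε hε => ?_
  set r := Θ.luxNorm x + ε / 3 with hr_def
  set s := Θ.luxNorm y + ε / 3 with hs_def
  obtain ⟨hr, hr1⟩ := Θ.mem_luxSet_of_lt (x := x) (r := r) (by linarith)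
  obtain ⟨hs, hs1⟩ := Θ.mem_luxSet_of_lt (x := y) (r := s) (by linarith)
  have hrs : 0 < r + s := by positivity
  have hmem : r + s ∈ Θ.luxSet (x + y) := by
    refine ⟨hrs, ?_⟩
    have h := Θ.convex' (((r⁻¹ : ℝ) : 𝕜) • x) (((s⁻¹ : ℝ) : 𝕜) • y) (r / (r + s)) (s / (r + s))
      (by positivity) (by positivity) (by field_simp)
    rw [smul_smul, smul_smul, ← RCLike.ofReal_mul, ← RCLike.ofReal_mul] at h
    have h1 : r / (r + s) * r⁻¹ = (r + s)⁻¹ := by field_simp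
    have h2 : s / (r + s) * s⁻¹ = (r + s)⁻¹ := by field_simp
    rw [h1, h2, ← smul_add] at h
    refine h.trans ?_
    have h3 : r / (r + s) + s / (r + s) = 1 := by field_simp
    have h4 : 0 ≤ r / (r + s) := by positivity
    have h5 : 0 ≤ s / (r + s) := by positivity
    nlinarith
  have := csInf_le (Θ.luxSet_bddBelow (x + y)) hmem
  change Θ.luxNorm (x + y) ≤ r + s at this
  linarith

theorem luxNorm_zero : Θ.luxNorm (0 : X) = 0 := by
  refine le_antisymm (le_of_forall_pos_le_add fun ε hε => ?_) (Θ.luxNorm_nonneg 0)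
  have : ε ∈ Θ.luxSet (0 : X) := ⟨hε, by rw [smul_zero, Θ.map_zero']; exact zero_le_one⟩
  have := csInf_le (Θ.luxSet_bddBelow (0 : X)) this
  simpa [luxNorm] using this

theorem luxNorm_smul_le (c : 𝕜) (x : X) : Θ.luxNorm (c • x) ≤ ‖c‖ * Θ.luxNorm x := by
  by_cases hc : c = 0
  · simp [hc, luxNorm_zero]
  have hc' : 0 < ‖c‖ := norm_pos_iff.2 hc
  rw [← div_le_iff₀' hc']
  refine le_csInf (Θ.luxSet_nonempty x) ?_
  rintro r ⟨hr, hr1⟩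
  rw [div_le_iff₀' hc']
  refine csInf_le (Θ.luxSet_bddBelow _) ⟨by positivity, ?_⟩
  have hn : ‖(((‖c‖⁻¹ : ℝ) : 𝕜) * c)‖ = 1 := by
    rw [norm_mul, RCLike.norm_ofReal, abs_of_pos (inv_pos.2 hc'), inv_mul_cancel₀ hc'.ne']
  have h := Θ.symm' (((‖c‖⁻¹ : ℝ) : 𝕜) * c) (((r⁻¹ : ℝ) : 𝕜) • x) hn
  rw [smul_smul] at h
  rw [smul_smul, mul_inv, RCLike.ofReal_mul, mul_right_comm]
  rw [h]
  exact hr1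

theorem luxNorm_smul (c : 𝕜) (x : X) : Θ.luxNorm (c • x) = ‖c‖ * Θ.luxNorm x := by
  refine le_antisymm (Θ.luxNorm_smul_le c x) ?_
  by_cases hc : c = 0
  · simp [hc, luxNorm_zero]
  have hc' : 0 < ‖c‖ := norm_pos_iff.2 hc
  have h := Θ.luxNorm_smul_le c⁻¹ (c • x)
  rw [inv_smul_smul₀ hc, norm_inv] at h
  calc ‖c‖ * Θ.luxNorm x ≤ ‖c‖ * (‖c‖⁻¹ * Θ.luxNorm (c • x)) := by gcongr
    _ = Θ.luxNorm (c • x) := by field_simp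

theorem eq_zero_of_luxNorm (x : X) (h : Θ.luxNorm x = 0) : x = 0 := by
  refine Θ.faithful' x (le_antisymm (le_of_forall_pos_le_add fun ε hε => ?_) (Θ.nonneg' x))
  set δ := min ε 1 with hδ
  have hδ0 : 0 < δ := by positivity
  obtain ⟨-, h1⟩ := Θ.mem_luxSet_of_lt (x := x) (r := δ) (by rw [h]; exact hδ0)
  have h2 := Θ.smul_le (((δ⁻¹ : ℝ) : 𝕜) • x) hδ0.le (min_le_right _ _)
  rw [smul_smul, ← RCLike.ofReal_mul, mul_inv_cancel₀ hδ0.ne', RCLike.ofReal_one, one_smul] at h2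
  have h3 : δ ≤ ε := min_le_left _ _
  nlinarith

/-- The vector space `X`, to be equipped with the Luxemburg norm of the convex modular `Θ`. -/
def Space (_Θ : ConvexModular 𝕜 X) : Type v := X

instance : AddCommGroup Θ.Space := inferInstanceAs (AddCommGroup X)

instance : Module 𝕜 Θ.Space := inferInstanceAs (Module 𝕜 X)

instance : Norm Θ.Space := ⟨fun x => Θ.luxNorm (X := X) x⟩

theorem space_core : NormedSpace.Core 𝕜 Θ.Space where
  norm_nonneg x := Θ.luxNorm_nonneg x
  norm_smul c x := Θ.luxNorm_smul c x
  norm_triangle x y := Θ.luxNorm_add_le x y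
  norm_eq_zero_iff x := ⟨Θ.eq_zero_of_luxNorm x, fun h => by
    rw [h]; exact Θ.luxNorm_zero⟩

instance : NormedAddCommGroup Θ.Space := NormedAddCommGroup.ofCore Θ.space_core

instance : NormedSpace 𝕜 Θ.Space := NormedSpace.ofCore Θ.space_core

end Basic

/-- The modular `Θ₁ x + Θ₂ y` of the modular direct sum of two modular spaces. -/
def sum {𝕜 : Type u} [RCLike 𝕜] {X : Type v} [AddCommGroup X] [Module 𝕜 X]
    {Y : Type w} [AddCommGroup Y] [Module 𝕜 Y]
    (Θ₁ : ConvexModular 𝕜 X) (Θ₂ : ConvexModular 𝕜 Y) : ConvexModular 𝕜 (X × Y) where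
  toFun z := Θ₁ z.1 + Θ₂ z.2
  nonneg' z := add_nonneg (Θ₁.nonneg' _) (Θ₂.nonneg' _)
  map_zero' := by simp [Θ₁.map_zero', Θ₂.map_zero']
  convex' x y a b ha hb hab := by
    have h1 := Θ₁.convex' x.1 y.1 a b ha hb hab
    have h2 := Θ₂.convex' x.2 y.2 a b ha hb hab
    simp only [Prod.fst_add, Prod.snd_add, Prod.smul_fst, Prod.smul_snd]
    linarith
  symm' c x hc := by
    simp only [Prod.smul_fst, Prod.smul_snd]
    rw [Θ₁.symm' c _ hc, Θ₂.symm' c _ hc]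
  faithful' x hx := by
    have h1 := Θ₁.nonneg' x.1
    have h2 := Θ₂.nonneg' x.2
    exact Prod.ext (Θ₁.faithful' _ (by linarith)) (Θ₂.faithful' _ (by linarith))

/-- The trivial modular `‖x‖ ^ 2` of a normed space. Hilbert spaces carry this modular. -/
def normSq (𝕜 : Type u) [RCLike 𝕜] (X : Type v) [NormedAddCommGroup X] [NormedSpace 𝕜 X] :
    ConvexModular 𝕜 X where
  toFun x := ‖x‖ ^ 2
  nonneg' x := sq_nonneg _
  map_zero' := by simp
  convex' x y a b ha hb hab := by
    have h : ‖(a : 𝕜) • x + (b : 𝕜) • y‖ ≤ a * ‖x‖ + b * ‖y‖ := by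
      refine (norm_add_le _ _).trans ?_
      rw [norm_smul, norm_smul, RCLike.norm_ofReal, RCLike.norm_ofReal, abs_of_nonneg ha,
        abs_of_nonneg hb]
    refine (pow_le_pow_left₀ (norm_nonneg _) h 2).trans ?_
    obtain rfl : b = 1 - a := by linarith
    nlinarith [mul_nonneg (mul_nonneg ha hb) (sq_nonneg (‖x‖ - ‖y‖))]
  symm' c x hc := by rw [norm_smul, hc, one_mul]
  faithful' x hx := by simpa using hx

end ConvexModular

/-! ### Nakano spaces -/

/-- A bounded family of exponents `p i ∈ [1, ∞)`, indexed by `ι`. -/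
structure NakanoExponents (ι : Type w) where
  toFun : ι → ℝ
  one_le' : ∀ i, 1 ≤ toFun i
  bddAbove' : BddAbove (Set.range toFun)

namespace NakanoExponents

instance {ι : Type w} : CoeFun (NakanoExponents ι) (fun _ => ι → ℝ) := ⟨toFun⟩

variable {ι : Type w} (p : NakanoExponents ι)

theorem convex_aux (𝕜 : Type u) [RCLike 𝕜] (i : ι) (x y : 𝕜) (a b : ℝ) (ha : 0 ≤ a) (hb : 0 ≤ b)
    (hab : a + b = 1) :
    ‖(a : 𝕜) * x + (b : 𝕜) * y‖ ^ p i ≤ a * ‖x‖ ^ p i + b * ‖y‖ ^ p i := by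
  have h : ‖(a : 𝕜) * x + (b : 𝕜) * y‖ ≤ a * ‖x‖ + b * ‖y‖ := by
    refine (norm_add_le _ _).trans ?_
    rw [norm_mul, norm_mul, RCLike.norm_ofReal, RCLike.norm_ofReal, abs_of_nonneg ha,
      abs_of_nonneg hb]
  have hp : 0 ≤ p i := zero_le_one.trans (p.one_le' i)
  refine (Real.rpow_le_rpow (norm_nonneg _) h hp).trans ?_
  exact (convexOn_rpow (p.one_le' i)).2 (norm_nonneg x) (norm_nonneg y) ha hb hab

theorem summable_smul {𝕜 : Type u} [RCLike 𝕜] (c : 𝕜) {x : ι → 𝕜}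
    (hx : Summable fun i => ‖x i‖ ^ p i) : Summable fun i => ‖c * x i‖ ^ p i := by
  obtain ⟨M, hM⟩ := p.bddAbove'
  refine Summable.of_nonneg_of_le (fun i => Real.rpow_nonneg (norm_nonneg _) _) (fun i => ?_)
    (hx.mul_left ((max ‖c‖ 1) ^ M))
  rw [norm_mul, Real.mul_rpow (norm_nonneg _) (norm_nonneg _)]
  have hp : 0 ≤ p i := zero_le_one.trans (p.one_le' i)
  refine mul_le_mul_of_nonneg_right ?_ (Real.rpow_nonneg (norm_nonneg _) _)
  exact (Real.rpow_le_rpow (norm_nonneg _) (le_max_left _ _) hp).trans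
    (Real.rpow_le_rpow_of_exponent_le (le_max_right _ _) (hM ⟨i, rfl⟩))

theorem summable_add {𝕜 : Type u} [RCLike 𝕜] {x y : ι → 𝕜}
    (hx : Summable fun i => ‖x i‖ ^ p i) (hy : Summable fun i => ‖y i‖ ^ p i) :
    Summable fun i => ‖x i + y i‖ ^ p i := by
  have h : Summable fun i => ‖((1 / 2 : ℝ) : 𝕜) * x i + ((1 / 2 : ℝ) : 𝕜) * y i‖ ^ p i :=
    Summable.of_nonneg_of_le (fun i => Real.rpow_nonneg (norm_nonneg _) _)
      (fun i => p.convex_aux 𝕜 i (x i) (y i) (1 / 2) (1 / 2) (by norm_num) (by norm_num)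
        (by norm_num)) ((hx.mul_left _).add (hy.mul_left _))
  refine (p.summable_smul (2 : 𝕜) h).congr fun i => ?_
  congr 2
  push_cast
  ring

/-- The underlying vector space of the Nakano space `ℓ_(p)`: all scalar families `x` with
`∑ i, |x i| ^ p i < ∞`. -/
def carrier (𝕜 : Type u) [RCLike 𝕜] : Submodule 𝕜 (ι → 𝕜) where
  carrier := {x | Summable fun i => ‖x i‖ ^ p i}
  zero_mem' := by
    have h : ∀ i, p i ≠ 0 := fun i => (zero_lt_one.trans_le (p.one_le' i)).ne'
    simp [Real.zero_rpow (h _), summable_zero]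
  add_mem' hx hy := p.summable_add hx hy
  smul_mem' c _ hx := p.summable_smul c hx

/-- The modular `Θ x = ∑ i, |x i| ^ p i` of the Nakano space. -/
def modular (𝕜 : Type u) [RCLike 𝕜] : ConvexModular 𝕜 (p.carrier 𝕜) where
  toFun x := ∑' i, ‖(x : ι → 𝕜) i‖ ^ p i
  nonneg' x := tsum_nonneg fun i => Real.rpow_nonneg (norm_nonneg _) _
  map_zero' := by
    have h : ∀ i, p i ≠ 0 := fun i => (zero_lt_one.trans_le (p.one_le' i)).ne'
    simp [Real.zero_rpow (h _)]
  convex' x y a b ha hb hab := by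
    have hx : Summable fun i => ‖(x : ι → 𝕜) i‖ ^ p i := x.2
    have hy : Summable fun i => ‖(y : ι → 𝕜) i‖ ^ p i := y.2
    rw [← tsum_mul_left, ← tsum_mul_left, ← (hx.mul_left a).tsum_add (hy.mul_left b)]
    exact Summable.tsum_le_tsum (fun i => p.convex_aux 𝕜 i _ _ a b ha hb hab)
      ((a : 𝕜) • x + (b : 𝕜) • y).2 ((hx.mul_left a).add (hy.mul_left b))
  symm' c x hc := by simp [hc]
  faithful' x hx := by
    have hs : Summable fun i => ‖(x : ι → 𝕜) i‖ ^ p i := x.2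
    have h := (hs.hasSum_iff.2 hx)
    rw [hasSum_zero_iff_of_nonneg fun i => Real.rpow_nonneg (norm_nonneg _) _] at h
    ext i
    have hi := congrFun h i
    have hp : p i ≠ 0 := (zero_lt_one.trans_le (p.one_le' i)).ne'
    simpa using (Real.rpow_eq_zero (norm_nonneg _) hp).1 hi

/-- The Nakano space `ℓ_(p)`, with its Luxemburg norm. -/
abbrev Nakano (𝕜 : Type u) [RCLike 𝕜] : Type (max u w) := (p.modular 𝕜).Space

/-- The subfamily of the exponents that differ from `2`. -/
def nonHilbert : NakanoExponents {i : ι // p i ≠ 2} where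
  toFun i := p i
  one_le' i := p.one_le' i
  bddAbove' := p.bddAbove'.mono (by rintro _ ⟨i, rfl⟩; exact ⟨i, rfl⟩)

/-- The modular direct sum `N_nh ⊕_m H` of the Nakano space `N_nh` of the exponents different
from `2` with the space `H` (with modular `‖h‖ ^ 2`), normed by the Luxemburg norm. -/
abbrev NonHilbertSum (𝕜 : Type u) [RCLike 𝕜] (H : Type v) [NormedAddCommGroup H]
    [NormedSpace 𝕜 H] : Type (max u v w) :=
  ((p.nonHilbert.modular 𝕜).sum (ConvexModular.normSq 𝕜 H)).Space

end NakanoExponents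

/-! ### Banach spaces, ultrapowers and elementary classes -/

/-- The bounded families that tend to `0` along the ultrafilter `U`. -/
def nullFamilies (𝕜 : Type w) [RCLike 𝕜] (X : Type u) [NormedAddCommGroup X] [NormedSpace 𝕜 X]
    {I : Type v} (U : Ultrafilter I) : Submodule 𝕜 (lp (fun _ : I => X) ∞) where
  carrier := {f | Tendsto (fun i => f i) U (𝓝 0)}
  zero_mem' := by simp
  add_mem' {f g} hf hg := by simpa using Tendsto.add hf hg
  smul_mem' c f hf := by simpa using Tendsto.const_smul hf c

instance nullFamilies_isClosed (𝕜 : Type w) [RCLike 𝕜] (X : Type u) [NormedAddCommGroup X]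
    [NormedSpace 𝕜 X] {I : Type v} (U : Ultrafilter I) :
    IsClosed (nullFamilies 𝕜 X U : Set (lp (fun _ : I => X) ∞)) := by
  refine isClosed_of_closure_subset fun f hf => ?_
  change Tendsto (fun i => f i) U (𝓝 0)
  rw [Metric.tendsto_nhds]
  intro ε hε
  obtain ⟨g, hg, hfg⟩ := Metric.mem_closure_iff.1 hf (ε / 2) (half_pos hε)
  have hg' : Tendsto (fun i => g i) U (𝓝 0) := hg
  filter_upwards [Metric.tendsto_nhds.1 hg' (ε / 2) (half_pos hε)] with i hi
  have h1 : ‖(f - g) i‖ ≤ ‖f - g‖ := lp.norm_apply_le_norm ENNReal.top_ne_zero (f - g) i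
  rw [dist_eq_norm] at hfg
  rw [dist_zero_right] at hi ⊢
  calc ‖f i‖ = ‖(f - g) i + g i‖ := by simp
    _ ≤ ‖(f - g) i‖ + ‖g i‖ := norm_add_le _ _
    _ < ε := by linarith

/-- The Banach space ultrapower `X_U`: the quotient of `ℓ_∞(I, X)` by the closed subspace of the
families that tend to `0` along `U`, with the quotient norm. -/
abbrev BanachUltrapower (𝕜 : Type w) [RCLike 𝕜] (X : Type u) [NormedAddCommGroup X]
    [NormedSpace 𝕜 X] {I : Type v} (U : Ultrafilter I) : Type (max u v) :=
  lp (fun _ : I => X) ∞ ⧸ nullFamilies 𝕜 X U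

/-- `X` and `Y` are elementarily equivalent: some ultrapowers of `X` and `Y` (with index sets
in `Type w`) are linearly isometric. -/
def BanachElemEquiv.{w', u', v', k'} (𝕜 : Type k') [RCLike 𝕜]
    (X : Type u') [NormedAddCommGroup X] [NormedSpace 𝕜 X]
    (Y : Type v') [NormedAddCommGroup Y] [NormedSpace 𝕜 Y] : Prop :=
  ∃ (I J : Type w') (U : Ultrafilter I) (V : Ultrafilter J),
    Nonempty (BanachUltrapower 𝕜 X U ≃ₗᵢ[𝕜] BanachUltrapower 𝕜 Y V)

/-- A Banach space over `𝕜`, with underlying type in `Type u`. -/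
structure BanachSp.{k', u'} (𝕜 : Type k') [RCLike 𝕜] : Type (max k' (u' + 1)) where
  carrier : Type u'
  [normedAddCommGroup : NormedAddCommGroup carrier]
  [normedSpace : NormedSpace 𝕜 carrier]
  [completeSpace : CompleteSpace carrier]

attribute [instance] BanachSp.normedAddCommGroup BanachSp.normedSpace BanachSp.completeSpace

namespace BanachSp

instance {𝕜 : Type v} [RCLike 𝕜] : CoeSort (BanachSp.{v, u} 𝕜) (Type u) := ⟨carrier⟩

/-- The ultrapower of a Banach space, as a Banach space. -/
def ultrapower {𝕜 : Type v} [RCLike 𝕜] (X : BanachSp.{v, u} 𝕜) {I : Type u}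
    (U : Ultrafilter I) : BanachSp.{v, u} 𝕜 := ⟨BanachUltrapower 𝕜 X U⟩

/-- The density character: the least cardinality of a dense subset. -/
def density {𝕜 : Type v} [RCLike 𝕜] (X : BanachSp.{v, u} 𝕜) : Cardinal.{u} :=
  sInf {c | ∃ s : Set X, Dense s ∧ Cardinal.mk s = c}

/-- The elementary class of `N`: all Banach spaces that are elementarily equivalent to `N`. -/
def elementaryClass (𝕜 : Type v) [RCLike 𝕜] (N : Type w) [NormedAddCommGroup N]
    [NormedSpace 𝕜 N] : Set (BanachSp.{v, u} 𝕜) :=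
  {X | BanachElemEquiv.{u} 𝕜 X N}

/-- A class of Banach spaces is closed under ultrapowers. -/
def ClosedUnderUltrapowers {𝕜 : Type v} [RCLike 𝕜] (C : Set (BanachSp.{v, u} 𝕜)) : Prop :=
  ∀ X ∈ C, ∀ (I : Type u) (U : Ultrafilter I), X.ultrapower U ∈ C

/-- A class of Banach spaces is closed under ultraroots: it contains every Banach space some
ultrapower of which is linearly isometric to a member of the class. -/
def ClosedUnderUltraroots {𝕜 : Type v} [RCLike 𝕜] (C : Set (BanachSp.{v, u} 𝕜)) : Prop :=
  ∀ (X : BanachSp.{v, u} 𝕜), ∀ Y ∈ C, ∀ (I : Type u) (U : Ultrafilter I),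
    Nonempty (X.ultrapower U ≃ₗᵢ[𝕜] Y) → X ∈ C

/-- Up to linear isometry, the class contains exactly one member of density character `κ`. -/
def CategoricalIn {𝕜 : Type v} [RCLike 𝕜] (C : Set (BanachSp.{v, u} 𝕜)) (κ : Cardinal.{u}) :
    Prop :=
  (∃ X ∈ C, X.density = κ) ∧
    ∀ X ∈ C, ∀ Y ∈ C, X.density = κ → Y.density = κ → Nonempty (X ≃ₗᵢ[𝕜] Y)

/-- A class of Banach spaces is uncountably categorical: it is closed under ultrapowers and
ultraroots, and contains, up to linear isometry, exactly one member of density character `κ`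
for every uncountable cardinal `κ` (in particular, for some uncountable cardinal). -/
def UncountablyCategorical {𝕜 : Type v} [RCLike 𝕜] (C : Set (BanachSp.{v, u} 𝕜)) : Prop :=
  ClosedUnderUltrapowers C ∧ ClosedUnderUltraroots C ∧
    ∀ κ : Cardinal.{u}, Cardinal.aleph0 < κ → CategoricalIn C κ

end BanachSp

end

/-! The central object is a null family: a bounded family of vectors of a Nakano space whose
coordinates all tend to `0` along an ultrafilter. Its mass escapes every finite set of coordinates
and so sits where the exponents are close to `2`. In the limit its modular is therefore
2-homogeneous and obeys the parallelogram law, and a Brezis–Lieb estimate makes it additive against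
a fixed vector. Subtracting from a bounded family its coordinatewise limit leaves a null family. So
an ultrapower of such a Nakano space is its modular direct sum with a Hilbert space
(`exists_isometryEquiv_nullPart`), that is, the same Nakano space with further exponents equal to
`2` (`exists_ultrapower_equiv`).

For ultraroots, let an ultrapower of an infinite dimensional `X` be a Nakano space of this kind. A
Banach–Saks argument shows that the ultrapower still splits into the diagonal copy of `X` and a null
part. The norm alone recovers the modular: a vector is completed to the unit sphere by null vectors
taken from `X`, and on the sphere the modular is `1`. Hence the modular is additive on the splitting
(`energy_map_diag_add`). If a unit vector with exponent `r` has a null part of norm `c`, comparing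
modulars at scale `t` gives `t ^ r * A = 2 * t ^ 2 * c ^ 2` for all small `t`; so `r ≠ 2` forces `c
= 0`, and the unit vector comes from `X` (`exists_map_diag_eq_unit`). Thus `X` contains `N_nh` and
is its modular direct sum with a closed subspace of the Hilbert part.

Conversely, infinite dimensional spaces `N_nh ⊕_m H` differ only in the Hilbert dimension. Along an
ultrafilter finer than `atTop` on the finite subsets of a large enough set `κ`, the index set of the
ultrapower has cardinality `2 ^ κ` (`mk_eq_of_ultrapower`), so suitable ultrapowers of any two of
them are isometric. Categoricity holds because an uncountable density character equals the number of
exponents, of which only countably many differ from `2`. -/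

namespace ConvexModular

/-! ### Modular versus Luxemburg norm, and the `Δ₂` condition. -/

section Energy

variable {𝕜 : Type u} [RCLike 𝕜] {X : Type v} [AddCommGroup X] [Module 𝕜 X]
  {Θ : ConvexModular 𝕜 X}

/-- The value of the modular at a vector of the associated normed space. -/
def energy (x : Θ.Space) : ℝ := Θ.toFun x

theorem energy_nonneg (x : Θ.Space) : 0 ≤ energy x := Θ.nonneg' x

@[simp] theorem energy_zero : energy (0 : Θ.Space) = 0 := Θ.map_zero'

theorem energy_smul_le (x : Θ.Space) {a : ℝ} (h0 : 0 ≤ a) (h1 : a ≤ 1) :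
    energy ((a : 𝕜) • x) ≤ a * energy x := Θ.smul_le (X := X) x h0 h1

theorem energy_smul_le_one_of_norm_lt {x : Θ.Space} {r : ℝ} (h : ‖x‖ < r) :
    energy (((r⁻¹ : ℝ) : 𝕜) • x) ≤ 1 := (Θ.mem_luxSet_of_lt (x := x) h).2

theorem norm_le_of_energy_smul_le_one {x : Θ.Space} {r : ℝ} (hr : 0 < r)
    (h : energy (((r⁻¹ : ℝ) : 𝕜) • x) ≤ 1) : ‖x‖ ≤ r :=
  csInf_le (Θ.luxSet_bddBelow (X := X) x) ⟨hr, h⟩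

theorem norm_le_one_of_energy_le_one {x : Θ.Space} (h : energy x ≤ 1) : ‖x‖ ≤ 1 :=
  norm_le_of_energy_smul_le_one one_pos (by simpa using h)

theorem one_lt_energy_of_lt_norm {x : Θ.Space} {r : ℝ} (hr : 0 < r) (h : r < ‖x‖) :
    1 < energy (((r⁻¹ : ℝ) : 𝕜) • x) := by
  by_contra! h1
  exact absurd (norm_le_of_energy_smul_le_one hr h1) (not_le.2 h)

/-- Passing through a scale strictly between `‖x‖` and `r`, convexity improves `≤ 1` to `< 1`. The
strict inequality survives small perturbations, as limit arguments require. -/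
theorem energy_smul_lt_one_of_norm_lt {x : Θ.Space} {r : ℝ} (h : ‖x‖ < r) :
    energy (((r⁻¹ : ℝ) : 𝕜) • x) < 1 := by
  obtain ⟨s, hs, hsr⟩ := exists_between h
  have hs0 : 0 < s := (norm_nonneg x).trans_lt hs
  have hr0 : 0 < r := hs0.trans hsr
  have h1 := energy_smul_le_one_of_norm_lt hs
  have hq : s / r < 1 := (div_lt_one hr0).2 hsr
  have hq0 : 0 ≤ s / r := by positivity
  have h2 := energy_smul_le (((s⁻¹ : ℝ) : 𝕜) • x) hq0 hq.le
  rw [smul_smul, ← RCLike.ofReal_mul, show s / r * s⁻¹ = r⁻¹ by field_simp] at h2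
  nlinarith

theorem energy_lt_one_of_norm_lt_one {x : Θ.Space} (h : ‖x‖ < 1) : energy x < 1 := by
  simpa using energy_smul_lt_one_of_norm_lt h

theorem norm_eq_one_of_energy_eq_one {x : Θ.Space} (h : energy x = 1) : ‖x‖ = 1 := by
  refine le_antisymm (norm_le_one_of_energy_le_one h.le) ?_
  by_contra! h1
  exact absurd h (energy_lt_one_of_norm_lt_one h1).ne

/-- Convergence of the modulars at every scale entails convergence of the Luxemburg norms. -/
theorem tendsto_norm_of_tendsto_energy {Y : Type w} [AddCommGroup Y] [Module 𝕜 Y]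
    {Ψ : ConvexModular 𝕜 Y} {I : Type*} {l : Filter I} {x : I → Θ.Space} {y : Ψ.Space}
    (h : ∀ t : ℝ, 0 < t →
      Tendsto (fun k => energy ((t : 𝕜) • x k)) l (𝓝 (energy ((t : 𝕜) • y)))) :
    Tendsto (fun k => ‖x k‖) l (𝓝 ‖y‖) := by
  -- A bound on the norm on either side becomes a strict inequality between `1` and the modular at
  -- one intermediate scale, hence an open condition.
  refine tendsto_order.2 ⟨fun a ha => ?_, fun a ha => ?_⟩
  · rcases lt_or_ge a 0 with h0 | h0
    · exact Eventually.of_forall fun k => h0.trans_le (norm_nonneg _)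
    obtain ⟨r, har, hr⟩ := exists_between ha
    have hr0 : 0 < r := h0.trans_lt har
    filter_upwards [(h r⁻¹ (inv_pos.2 hr0)).eventually_const_lt
      (one_lt_energy_of_lt_norm hr0 hr)] with k hk
    by_contra! h1
    exact absurd (energy_smul_le_one_of_norm_lt (h1.trans_lt har)) (not_le.2 hk)
  · obtain ⟨r, hr, hra⟩ := exists_between ha
    have hr0 : 0 < r := (norm_nonneg _).trans_lt hr
    filter_upwards [(h r⁻¹ (inv_pos.2 hr0)).eventually_lt_const
      (energy_smul_lt_one_of_norm_lt hr)] with k hk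
    exact (norm_le_of_energy_smul_le_one hr0 hk.le).trans_lt hra

variable (Θ) in
/-- The `Δ₂` condition: the modular grows at most like the `P`-th power. -/
def Doubling (P : ℕ) : Prop :=
  ∀ (c : ℝ) (x : Θ.Space), 1 ≤ c → energy ((c : 𝕜) • x) ≤ c ^ P * energy x

theorem Doubling.energy_le {P : ℕ} (h : Θ.Doubling P) {x : Θ.Space} {R : ℝ} (hR : 1 ≤ R)
    (hx : ‖x‖ ≤ R) : energy x ≤ R ^ P := by
  have key : ∀ r, R < r → energy x ≤ r ^ P := fun r hr => by
    have hr0 : 0 < r := by linarith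
    have h1 := h r (((r⁻¹ : ℝ) : 𝕜) • x) (by linarith)
    rw [smul_smul, ← RCLike.ofReal_mul, mul_inv_cancel₀ hr0.ne', RCLike.ofReal_one, one_smul] at h1
    exact h1.trans (mul_le_of_le_one_right (by positivity)
      (energy_smul_le_one_of_norm_lt (hx.trans_lt hr)))
  have hc : Tendsto (fun r : ℝ => r ^ P) (𝓝[>] R) (𝓝 (R ^ P)) :=
    ((continuous_pow P).tendsto R).mono_left nhdsWithin_le_nhds
  exact ge_of_tendsto hc (eventually_nhdsWithin_of_forall fun r hr => key r hr)

/-- Scaling by `r > 1` pushes the vector out of the unit ball while multiplying its modular by at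
most `r ^ P`; then `r` decreases to `1`. This is how equalities of norms are read back as equalities
of modulars. -/
theorem Doubling.energy_eq_one {P : ℕ} (h : Θ.Doubling P) {x : Θ.Space} (hx : ‖x‖ = 1) :
    energy x = 1 := by
  refine le_antisymm (by simpa using h.energy_le le_rfl hx.le) ?_
  have key : ∀ r : ℝ, 1 < r → 1 ≤ r ^ P * energy x := fun r hr => by
    refine (one_lt_energy_of_lt_norm (x := x) (r := r⁻¹) (by positivity) ?_).le.trans ?_
    · rw [hx]; exact inv_lt_one_of_one_lt₀ hr
    · rw [inv_inv]; exact h r x hr.le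
  have hc : Tendsto (fun r : ℝ => r ^ P * energy x) (𝓝[>] 1) (𝓝 (1 ^ P * energy x)) :=
    (((continuous_pow P).mul continuous_const).tendsto 1).mono_left nhdsWithin_le_nhds
  simpa using ge_of_tendsto hc (eventually_nhdsWithin_of_forall fun r hr => key r hr)

theorem Doubling.tendsto_energy_smul {P : ℕ} (h : Θ.Doubling P) {I : Type*} {l : Filter I}
    {x : I → Θ.Space} (hx : Tendsto (fun k => energy (x k)) l (𝓝 0)) (t : ℝ) (ht : 0 < t) :
    Tendsto (fun k => energy ((t : 𝕜) • x k)) l (𝓝 0) := by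
  refine squeeze_zero (fun k => energy_nonneg _) (g := fun k => (max t 1) ^ P * energy (x k))
    (fun k => ?_) (by simpa using hx.const_mul ((max t 1) ^ P))
  rcases le_total t 1 with h1 | h1
  · rw [max_eq_right h1, one_pow, one_mul]
    exact (energy_smul_le _ ht.le h1).trans (mul_le_of_le_one_left (energy_nonneg _) h1)
  · rw [max_eq_left h1]
    exact h t _ h1

theorem Doubling.tendsto_norm_zero {P : ℕ} (h : Θ.Doubling P) {I : Type*} {l : Filter I}
    {x : I → Θ.Space} (hx : Tendsto (fun k => energy (x k)) l (𝓝 0)) :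
    Tendsto (fun k => ‖x k‖) l (𝓝 0) := by
  simpa using tendsto_norm_of_tendsto_energy (y := (0 : Θ.Space)) fun t ht => by
    simpa using h.tendsto_energy_smul hx t ht

theorem Doubling.tendsto_zero {P : ℕ} (h : Θ.Doubling P) {I : Type*} {l : Filter I}
    {x : I → Θ.Space} (hx : Tendsto (fun k => energy (x k)) l (𝓝 0)) :
    Tendsto x l (𝓝 0) :=
  tendsto_zero_iff_norm_tendsto_zero.2 (h.tendsto_norm_zero hx)

/-- A linear equivalence that preserves the modulars is isometric for the Luxemburg norms. -/
def isometryOfEnergy {Y : Type w} [AddCommGroup Y] [Module 𝕜 Y] {Ψ : ConvexModular 𝕜 Y}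
    (e : X ≃ₗ[𝕜] Y) (h : ∀ x, Ψ (e x) = Θ x) : Θ.Space ≃ₗᵢ[𝕜] Ψ.Space :=
  { (show Θ.Space ≃ₗ[𝕜] Ψ.Space from e) with
    norm_map' := fun x => by
      have key : ∀ z : X, Ψ.luxNorm (e z) = Θ.luxNorm z := fun z => by
        simp only [luxNorm, luxSet, ← map_smul, h]
      exact key x }

end Energy

/-! ### Modular direct sums and the modular of a Hilbert space. -/

section Sum

variable {𝕜 : Type u} [RCLike 𝕜] {X : Type v} [AddCommGroup X] [Module 𝕜 X]
  {Y : Type w} [AddCommGroup Y] [Module 𝕜 Y]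
  {Θ : ConvexModular 𝕜 X} {Ψ : ConvexModular 𝕜 Y}

/-- The element of a modular direct sum with given components. -/
def pair (x : Θ.Space) (y : Ψ.Space) : (Θ.sum Ψ).Space := show X × Y from (x, y)

theorem energy_pair (x : Θ.Space) (y : Ψ.Space) : energy (pair x y) = energy x + energy y := rfl

theorem smul_pair (c : 𝕜) (x : Θ.Space) (y : Ψ.Space) : c • pair x y = pair (c • x) (c • y) := rfl

theorem Doubling.sum {P Q : ℕ} (h : Θ.Doubling P) (h' : Ψ.Doubling Q) :
    (Θ.sum Ψ).Doubling (P + Q) := by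
  intro c z hc
  have h1 := h c z.1 hc
  have h2 := h' c z.2 hc
  have e0 : energy z = energy (Θ := Θ) z.1 + energy (Θ := Ψ) z.2 := rfl
  have e1 : energy ((c : 𝕜) • z) = energy (Θ := Θ) ((c : 𝕜) • (z.1 : Θ.Space)) +
    energy (Θ := Ψ) ((c : 𝕜) • (z.2 : Ψ.Space)) := rfl
  rw [e0, e1, mul_add]
  refine add_le_add (h1.trans ?_) (h2.trans ?_)
  · exact mul_le_mul_of_nonneg_right (pow_le_pow_right₀ hc (by omega)) (energy_nonneg _)
  · exact mul_le_mul_of_nonneg_right (pow_le_pow_right₀ hc (by omega)) (energy_nonneg _)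

end Sum

section NormSq

variable {𝕜 : Type u} [RCLike 𝕜] {X : Type v} [NormedAddCommGroup X] [NormedSpace 𝕜 X]

variable (𝕜) in
/-- A vector of a normed space, seen in the Luxemburg space of its modular `‖x‖ ^ 2`. -/
def toSq (x : X) : (normSq 𝕜 X).Space := x

theorem smul_toSq (c : 𝕜) (x : X) : c • toSq 𝕜 x = toSq 𝕜 (c • x) := rfl

theorem energy_toSq (x : X) : energy (toSq 𝕜 x) = ‖x‖ ^ 2 := rfl

theorem norm_toSq (x : X) : ‖toSq 𝕜 x‖ = ‖x‖ := by
  refine eq_of_forall_gt_iff fun r => ⟨fun h => ?_, fun h => ?_⟩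
  · have hr : 0 < r := (norm_nonneg _).trans_lt h
    have h1 := energy_smul_lt_one_of_norm_lt h
    rw [smul_toSq, energy_toSq, norm_smul, RCLike.norm_ofReal, abs_of_pos (inv_pos.2 hr)] at h1
    have h2 := (sq_lt_one_iff₀ (by positivity)).1 h1
    rwa [inv_mul_lt_iff₀ hr, mul_one] at h2
  · have hr : 0 < r := (norm_nonneg _).trans_lt h
    obtain ⟨s, hs, hsr⟩ := exists_between h
    have hs0 : 0 < s := (norm_nonneg _).trans_lt hs
    refine (norm_le_of_energy_smul_le_one hs0 ?_).trans_lt hsr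
    rw [smul_toSq, energy_toSq, norm_smul, RCLike.norm_ofReal, abs_of_pos (inv_pos.2 hs0)]
    refine (sq_le_one_iff₀ (by positivity)).2 ?_
    rw [inv_mul_le_iff₀ hs0, mul_one]
    exact hs.le

theorem doubling_normSq : (normSq 𝕜 X).Doubling 2 := by
  intro c x hc
  change ‖(c : 𝕜) • (show X from x)‖ ^ 2 ≤ c ^ 2 * ‖(show X from x)‖ ^ 2
  rw [norm_smul, RCLike.norm_ofReal, abs_of_nonneg (by linarith), mul_pow]

end NormSq

end ConvexModular

/-! ### Nakano spaces: coordinates, Fatou property, completeness, unit vectors. -/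

namespace NakanoExponents

open ConvexModular

variable {𝕜 : Type u} [RCLike 𝕜] {ι : Type v} {q : NakanoExponents ι}

theorem pos (q : NakanoExponents ι) (i : ι) : 0 < q i := zero_lt_one.trans_le (q.one_le' i)

theorem exists_nat_bound (q : NakanoExponents ι) : ∃ P : ℕ, ∀ i, q i ≤ P := by
  obtain ⟨M, hM⟩ := q.bddAbove'
  obtain ⟨P, hP⟩ := exists_nat_ge M
  exact ⟨P, fun i => (hM ⟨i, rfl⟩).trans hP⟩

/-- The coordinate functionals of a Nakano space. -/
def coord (i : ι) : q.Nakano 𝕜 →ₗ[𝕜] 𝕜 where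
  toFun x := (show q.carrier 𝕜 from x).1 i
  map_add' _ _ := rfl
  map_smul' _ _ := rfl

/-- The vector of a Nakano space with given coordinates. -/
def ofCoord (f : ι → 𝕜) (hf : Summable fun i => ‖f i‖ ^ q i) : q.Nakano 𝕜 :=
  show q.carrier 𝕜 from ⟨f, hf⟩

@[simp] theorem coord_ofCoord (f : ι → 𝕜) (hf : Summable fun i => ‖f i‖ ^ q i) (i : ι) :
    coord i (ofCoord f hf) = f i := rfl

theorem ext_coord {x y : q.Nakano 𝕜} (h : ∀ i, coord i x = coord i y) : x = y :=
  Subtype.ext (funext h)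

theorem summable_coord (x : q.Nakano 𝕜) : Summable fun i => ‖coord i x‖ ^ q i :=
  (show q.carrier 𝕜 from x).2

theorem energy_eq (x : q.Nakano 𝕜) : energy x = ∑' i, ‖coord i x‖ ^ q i := rfl

theorem term_nonneg (x : q.Nakano 𝕜) (i : ι) : 0 ≤ ‖coord i x‖ ^ q i :=
  Real.rpow_nonneg (norm_nonneg _) _

theorem term_le_energy (x : q.Nakano 𝕜) (i : ι) : ‖coord i x‖ ^ q i ≤ energy x :=
  (summable_coord x).le_tsum i fun j _ => term_nonneg x j

theorem doubling {P : ℕ} (hP : ∀ i, q i ≤ P) : (q.modular 𝕜).Doubling P := by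
  intro c x hc
  rw [energy_eq, energy_eq, ← tsum_mul_left]
  refine Summable.tsum_le_tsum (fun i => ?_) (summable_coord _) ((summable_coord x).mul_left _)
  rw [map_smul, norm_smul, RCLike.norm_ofReal, abs_of_nonneg (by linarith),
    Real.mul_rpow (by linarith) (norm_nonneg _)]
  refine mul_le_mul_of_nonneg_right ?_ (term_nonneg x i)
  rw [← Real.rpow_natCast]
  exact Real.rpow_le_rpow_of_exponent_le hc (hP i)

theorem norm_coord_le (i : ι) (x : q.Nakano 𝕜) : ‖coord i x‖ ≤ ‖x‖ := by
  refine le_of_forall_gt fun r hr => ?_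
  have hr0 : 0 < r := (norm_nonneg x).trans_lt hr
  have h := (term_le_energy _ i).trans_lt (energy_smul_lt_one_of_norm_lt hr)
  rw [map_smul, norm_smul, RCLike.norm_ofReal, abs_of_pos (inv_pos.2 hr0)] at h
  have h1 : r⁻¹ * ‖coord i x‖ < 1 := by
    by_contra! h2
    exact absurd (Real.one_le_rpow h2 (q.pos i).le) (not_le.2 h)
  rwa [inv_mul_lt_iff₀ hr0, mul_one] at h1

open Classical in
/-- The unit vectors of a Nakano space. -/
noncomputable def unit (i : ι) : q.Nakano 𝕜 :=
  ofCoord (Pi.single i 1) <| summable_of_ne_finset_zero (s := {i}) fun j hj => by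
    have : j ≠ i := by simpa using hj
    rw [Pi.single_eq_of_ne this, norm_zero, Real.zero_rpow (q.pos j).ne']

@[simp] theorem coord_unit_self (i : ι) : coord i (unit i : q.Nakano 𝕜) = 1 := by
  classical
  simp [unit]

theorem coord_unit_of_ne {i j : ι} (h : j ≠ i) : coord j (unit i : q.Nakano 𝕜) = 0 := by
  classical
  simp [unit, h]

theorem energy_eq_add (x : q.Nakano 𝕜) (i : ι) {y : q.Nakano 𝕜} (hi : coord i y = 0)
    (h : ∀ j, j ≠ i → ‖coord j y‖ = ‖coord j x‖) :
    energy x = ‖coord i x‖ ^ q i + energy y := by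
  classical
  rw [energy_eq, energy_eq, (summable_coord x).tsum_eq_add_tsum_ite i]
  congr 1
  refine tsum_congr fun j => ?_
  split_ifs with hj
  · rw [hj, hi, norm_zero, Real.zero_rpow (q.pos i).ne']
  · rw [h j hj]

theorem energy_smul_unit (i : ι) (c : 𝕜) : energy (c • (unit i : q.Nakano 𝕜)) = ‖c‖ ^ q i := by
  rw [energy_eq_add (y := 0) _ i (by simp) fun j hj => by simp [coord_unit_of_ne hj]]
  simp

/-- A family bounded in norm has bounded modulars. -/
theorem exists_energy_bound {I : Type*} {x : I → q.Nakano 𝕜} {R : ℝ} (hx : ∀ k, ‖x k‖ ≤ R) :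
    ∃ M, 0 ≤ M ∧ ∀ k, energy (x k) ≤ M := by
  obtain ⟨P, hP⟩ := q.exists_nat_bound
  exact ⟨(max R 1) ^ P, by positivity, fun k =>
    (doubling hP).energy_le (le_max_right _ _) ((hx k).trans (le_max_left _ _))⟩

theorem tendsto_rpow_coord {I : Type*} {l : Filter I} {f : I → 𝕜} {a : 𝕜} (h : Tendsto f l (𝓝 a))
    {r : ℝ} (hr : 0 < r) : Tendsto (fun k => ‖f k‖ ^ r) l (𝓝 (‖a‖ ^ r)) :=
  (Real.continuousAt_rpow_const _ _ (Or.inr hr.le)).tendsto.comp h.norm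

/-- Fatou property: coordinatewise limits of families with bounded modulars. -/
theorem exists_of_tendsto_coord {I : Type*} {l : Filter I} [l.NeBot] {x : I → q.Nakano 𝕜} {M : ℝ}
    (hx : ∀ᶠ k in l, energy (x k) ≤ M) {y : ι → 𝕜}
    (hy : ∀ i, Tendsto (fun k => coord i (x k)) l (𝓝 (y i))) :
    ∃ z : q.Nakano 𝕜, (∀ i, coord i z = y i) ∧ energy z ≤ M := by
  have h : ∀ F : Finset ι, ∑ i ∈ F, ‖y i‖ ^ q i ≤ M := fun F => by
    refine le_of_tendsto (tendsto_finsetSum F fun i _ => tendsto_rpow_coord (hy i) (q.pos i)) ?_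
    filter_upwards [hx] with k hk
    exact ((summable_coord (x k)).sum_le_tsum F fun i _ => term_nonneg _ i).trans hk
  have hs : Summable fun i => ‖y i‖ ^ q i :=
    summable_of_sum_le (fun i => Real.rpow_nonneg (norm_nonneg _) _) h
  exact ⟨ofCoord y hs, fun i => rfl, hs.tsum_le_of_sum_le h⟩

/-- Bounded scalars converge along an ultrafilter, and the Fatou property puts the coordinatewise
limit back into the space. -/
theorem exists_limit {I : Type*} (U : Ultrafilter I) {x : I → q.Nakano 𝕜} {R : ℝ}
    (hx : ∀ k, ‖x k‖ ≤ R) :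
    ∃ y : q.Nakano 𝕜, ∀ i, Tendsto (fun k => coord i (x k)) U (𝓝 (coord i y)) := by
  have h : ∀ i, ∃ a, Tendsto (fun k => coord i (x k)) U (𝓝 a) := fun i => by
    obtain ⟨a, -, ha⟩ := (isCompact_closedBall (0 : 𝕜) R).ultrafilter_le_nhds
      (U.map fun k => coord i (x k)) (by
        refine le_principal_iff.2 (mem_map.2 (univ_mem' fun k => ?_))
        simpa using (norm_coord_le i (x k)).trans (hx k))
    exact ⟨a, ha⟩
  choose y hy using h
  obtain ⟨M, -, hM⟩ := exists_energy_bound hx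
  obtain ⟨z, hz, -⟩ := exists_of_tendsto_coord (Eventually.of_forall hM) hy
  exact ⟨z, fun i => by rw [hz]; exact hy i⟩

instance : CompleteSpace (q.Nakano 𝕜) := by
  refine Metric.complete_of_cauchySeq_tendsto fun x hx => ?_
  have hc : ∀ i, ∃ a, Tendsto (fun k => coord i (x k)) atTop (𝓝 a) := fun i => by
    refine cauchySeq_tendsto_of_complete (Metric.cauchySeq_iff'.2 fun ε hε => ?_)
    obtain ⟨N, hN⟩ := Metric.cauchySeq_iff'.1 hx ε hε
    refine ⟨N, fun n hn => ?_⟩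
    rw [dist_eq_norm, ← map_sub]
    exact (norm_coord_le i _).trans_lt (by simpa [dist_eq_norm] using hN n hn)
  choose y hy using hc
  obtain ⟨C, hC⟩ := hx.norm_bddAbove
  obtain ⟨M, -, hM⟩ := exists_energy_bound (x := x) fun k => hC ⟨k, rfl⟩
  obtain ⟨z, hz, -⟩ := exists_of_tendsto_coord (Eventually.of_forall hM) hy
  refine ⟨z, Metric.tendsto_atTop.2 fun ε hε => ?_⟩
  obtain ⟨N, hN⟩ := Metric.cauchySeq_iff.1 hx (ε / 2) (half_pos hε)
  refine ⟨N, fun n hn => ?_⟩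
  have hδ : 0 < ε / 2 := half_pos hε
  set c : 𝕜 := (((ε / 2)⁻¹ : ℝ) : 𝕜)
  -- The Fatou property, applied to the rescaled `x n - x m` as `m` grows, turns the Cauchy estimate
  -- into a norm bound for `x n - z`.
  obtain ⟨d, hd, hd1⟩ := exists_of_tendsto_coord (l := atTop) (M := 1)
    (x := fun m => c • (x n - x m)) (y := fun i => coord i (c • (x n - z))) (by
      filter_upwards [eventually_ge_atTop N] with m hm
      refine energy_smul_le_one_of_norm_lt ?_
      simpa [dist_eq_norm] using hN n hn m hm) (fun i => by
        simp only [map_smul, map_sub, hz]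
        exact ((tendsto_const_nhds.sub (hy i)).const_smul c))
  obtain rfl := ext_coord hd
  rw [dist_eq_norm]
  exact (norm_le_of_energy_smul_le_one hδ hd1).trans_lt (by linarith)

/-- The unit vectors span a dense subspace. -/
theorem tendsto_sum_unit (x : q.Nakano 𝕜) :
    Tendsto (fun F : Finset ι => ∑ i ∈ F, coord i x • (unit i : q.Nakano 𝕜)) atTop (𝓝 x) := by
  classical
  obtain ⟨P, hP⟩ := q.exists_nat_bound
  rw [tendsto_iff_norm_sub_tendsto_zero]
  refine (doubling hP).tendsto_norm_zero ?_
  have hco : ∀ (F : Finset ι) (j : ι), coord j (∑ i ∈ F, coord i x • (unit i : q.Nakano 𝕜) - x) =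
      if j ∈ F then 0 else - coord j x := fun F j => by
    rw [map_sub, map_sum]
    split_ifs with hj
    · rw [Finset.sum_eq_single_of_mem j hj fun i _ hi => by
        rw [map_smul, coord_unit_of_ne hi.symm, smul_zero]]
      simp
    · rw [Finset.sum_eq_zero fun i hi => by
        rw [map_smul, coord_unit_of_ne (fun h : j = i => hj (by rw [h]; exact hi)), smul_zero]]
      simp
  have he : ∀ F : Finset ι, energy (∑ i ∈ F, coord i x • (unit i : q.Nakano 𝕜) - x) =
      energy x - ∑ i ∈ F, ‖coord i x‖ ^ q i := fun F => by
    rw [eq_sub_iff_add_eq', energy_eq, energy_eq]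
    have h0 : ∑ i ∈ F, ‖coord i x‖ ^ q i = ∑' i, if i ∈ F then ‖coord i x‖ ^ q i else 0 := by
      rw [tsum_eq_sum (s := F) fun i hi => by simp [hi]]
      exact Finset.sum_congr rfl fun i hi => by simp [hi]
    rw [h0, ← Summable.tsum_add (summable_of_ne_finset_zero (s := F) fun i hi => by simp [hi])
      (summable_coord _)]
    refine tsum_congr fun i => ?_
    rw [hco]
    split_ifs with hi
    · simp [Real.zero_rpow (q.pos i).ne']
    · simp
  simp_rw [he]
  have := (summable_coord x).hasSum.const_sub (energy x)
  rwa [energy_eq, sub_self] at this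

end NakanoExponents

/-! ### Estimates for powers, uniform in the exponent, and dominated sums. -/

section RpowEstimates

variable {𝕜 : Type u} [RCLike 𝕜]

/-- Convexity is applied to `‖a‖ + ‖b‖` written as a combination with weight `θ` on `θ⁻¹ * ‖a‖`. The
cost on the `b` side is at most `((1 - θ)⁻¹) ^ P`, which is below `1 + ε` for small `θ`, for all
exponents up to `P` at once. -/
theorem exists_rpow_norm_add_le (P : ℕ) {ε : ℝ} (hε : 0 < ε) :
    ∃ C : ℝ, 0 ≤ C ∧ ∀ r : ℝ, 1 ≤ r → r ≤ P → ∀ a b : 𝕜,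
      ‖a + b‖ ^ r ≤ (1 + ε) * ‖b‖ ^ r + C * ‖a‖ ^ r := by
  have hlim : Tendsto (fun θ : ℝ => ((1 - θ)⁻¹) ^ P) (𝓝[>] 0) (𝓝 1) := by
    have h : ContinuousAt (fun θ : ℝ => ((1 - θ)⁻¹) ^ P) 0 := by
      refine ContinuousAt.pow (ContinuousAt.inv₀ (by fun_prop) (by norm_num)) P
    have := h.tendsto
    simp only [sub_zero, inv_one, one_pow] at this
    exact this.mono_left nhdsWithin_le_nhds
  obtain ⟨θ, hθ, hθ0, hθ1⟩ := ((hlim.eventually_lt_const (show (1 : ℝ) < 1 + ε by linarith)).and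
    (Ioo_mem_nhdsGT (zero_lt_one (α := ℝ)))).exists
  refine ⟨(θ⁻¹) ^ P, by positivity, fun r hr1 hrP a b => ?_⟩
  have hr0 : 0 ≤ r := by linarith
  have h1θ : 0 < 1 - θ := by linarith
  have hA : ∀ s : ℝ, 0 < s → s ≤ 1 → ∀ x : ℝ, 0 ≤ x →
      s * (s⁻¹ * x) ^ r ≤ (s⁻¹) ^ P * x ^ r := fun s hs hs1 x hx => by
    have h1 : 1 ≤ s⁻¹ := one_le_inv_iff₀.2 ⟨hs, hs1⟩
    rw [Real.mul_rpow (by positivity) hx, ← mul_assoc]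
    refine mul_le_mul_of_nonneg_right ?_ (Real.rpow_nonneg hx _)
    refine (mul_le_of_le_one_left (by positivity) hs1).trans ?_
    rw [← Real.rpow_natCast]
    exact Real.rpow_le_rpow_of_exponent_le h1 hrP
  calc ‖a + b‖ ^ r ≤ (‖a‖ + ‖b‖) ^ r := Real.rpow_le_rpow (norm_nonneg _) (norm_add_le _ _) hr0
    _ = (θ • (θ⁻¹ * ‖a‖) + (1 - θ) • ((1 - θ)⁻¹ * ‖b‖)) ^ r := by
        congr 1
        simp only [smul_eq_mul]
        field_simp
    _ ≤ θ • (θ⁻¹ * ‖a‖) ^ r + (1 - θ) • ((1 - θ)⁻¹ * ‖b‖) ^ r :=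
        (convexOn_rpow hr1).2 (Set.mem_Ici.2 (by positivity)) (Set.mem_Ici.2 (by positivity))
          hθ0.le h1θ.le (by ring)
    _ ≤ (θ⁻¹) ^ P * ‖a‖ ^ r + ((1 - θ)⁻¹) ^ P * ‖b‖ ^ r :=
        add_le_add (hA θ hθ0 hθ1.le _ (norm_nonneg _))
          (hA (1 - θ) h1θ (by linarith) _ (norm_nonneg _))
    _ ≤ (1 + ε) * ‖b‖ ^ r + (θ⁻¹) ^ P * ‖a‖ ^ r := by
        rw [add_comm]
        gcongr

/-- The Brezis–Lieb inequality, uniformly for exponents in a bounded interval. -/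
theorem exists_abs_rpow_norm_add_sub_le (P : ℕ) {ε : ℝ} (hε : 0 < ε) :
    ∃ C : ℝ, 0 ≤ C ∧ ∀ r : ℝ, 1 ≤ r → r ≤ P → ∀ a b : 𝕜,
      |‖a + b‖ ^ r - ‖b‖ ^ r - ‖a‖ ^ r| ≤ ε * ‖b‖ ^ r + C * ‖a‖ ^ r := by
  set δ := min ε 1 / 2
  have hδ : 0 < δ := by positivity
  have hδ1 : δ ≤ 1 / 2 := by
    have := min_le_right ε 1
    simp only [δ]; linarith
  have hδε : 2 * δ ≤ ε := by
    have := min_le_left ε 1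
    simp only [δ]; linarith
  obtain ⟨C, hC, h⟩ := exists_rpow_norm_add_le (𝕜 := 𝕜) P hδ
  refine ⟨2 * C + 1, by positivity, fun r hr1 hrP a b => ?_⟩
  have h1 := h r hr1 hrP a b
  -- The same upper bound for `b = -a + (a + b)` supplies the lower bound. It carries an error `δ *
  -- ‖a + b‖ ^ r`, absorbed by the first bound since `δ ≤ 1 / 2` and `2 * δ ≤ ε`.
  have h2 := h r hr1 hrP (-a) (a + b)
  rw [neg_add_cancel_left, norm_neg] at h2
  have hA : 0 ≤ ‖a‖ ^ r := Real.rpow_nonneg (norm_nonneg _) _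
  have hB : 0 ≤ ‖b‖ ^ r := Real.rpow_nonneg (norm_nonneg _) _
  generalize ‖a + b‖ ^ r = S at *
  generalize ‖a‖ ^ r = A at *
  generalize ‖b‖ ^ r = B at *
  have hCA : 0 ≤ C * A := mul_nonneg hC hA
  have hεB : 2 * δ * B ≤ ε * B := mul_le_mul_of_nonneg_right hδε hB
  have hδB : 0 ≤ δ * B := by positivity
  have h3 : δ * S ≤ δ * ((1 + δ) * B + C * A) := mul_le_mul_of_nonneg_left h1 hδ.le
  have h4 : δ * (δ * B) ≤ 1 / 2 * (δ * B) := mul_le_mul_of_nonneg_right hδ1 hδB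
  have h5 : δ * (C * A) ≤ 1 / 2 * (C * A) := mul_le_mul_of_nonneg_right hδ1 hCA
  rw [abs_le]
  constructor <;> nlinarith

/-- Joint continuity of `t ^ r` at every `(2, t)`, including `t = 0`, becomes uniform by compactness
of `[0, R]`. -/
theorem eventually_abs_rpow_sub_sq_le (R : ℝ) {ε : ℝ} (hε : 0 < ε) :
    ∀ᶠ r in 𝓝 (2 : ℝ), ∀ t ∈ Set.Icc 0 R, |t ^ r - t ^ 2| ≤ ε := by
  refine isCompact_Icc.eventually_forall_of_forall_eventually fun t _ => ?_
  have h : ContinuousAt (fun z : ℝ × ℝ => |z.2 ^ z.1 - z.2 ^ 2|) (2, t) := by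
    have h1 : ContinuousAt (fun z : ℝ × ℝ => z.2 ^ z.1) (2, t) :=
      ContinuousAt.rpow continuousAt_snd continuousAt_fst (Or.inr (by norm_num))
    exact (h1.sub (continuousAt_snd.pow 2)).abs
  have h2 := h.tendsto.eventually_lt_const (u := ε) (by simpa using hε)
  exact h2.mono fun z hz => hz.le

/-- Up to a small relative error, `‖·‖ ^ r` satisfies the parallelogram law if `r` is close
to `2`. -/
theorem eventually_abs_parallelogram_le {ε : ℝ} (hε : 0 < ε) :
    ∀ᶠ r in 𝓝 (2 : ℝ), ∀ a b : 𝕜,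
      |‖a + b‖ ^ r + ‖a - b‖ ^ r - 2 * ‖a‖ ^ r - 2 * ‖b‖ ^ r| ≤ ε * (‖a‖ ^ r + ‖b‖ ^ r) := by
  filter_upwards [eventually_abs_rpow_sub_sq_le 2 (show 0 < ε / 6 by positivity),
    eventually_gt_nhds (show (0 : ℝ) < 2 by norm_num)] with r hr hr0 a b
  -- By homogeneity one may normalize the larger norm to `1`. Then all norms are at most `2`, the
  -- right side is at least `ε`, and the coefficients `1, 1, 2, 2` add up to the `6` in `ε / 6`.
  have key : ∀ a b : 𝕜, max ‖a‖ ‖b‖ = 1 →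
      |‖a + b‖ ^ r + ‖a - b‖ ^ r - 2 * ‖a‖ ^ r - 2 * ‖b‖ ^ r| ≤ ε * (‖a‖ ^ r + ‖b‖ ^ r) := by
    intro a b hab
    have ha : ‖a‖ ≤ 1 := hab ▸ le_max_left _ _
    have hb : ‖b‖ ≤ 1 := hab ▸ le_max_right _ _
    have h1 := abs_le.1 (hr ‖a + b‖ ⟨norm_nonneg _, (norm_add_le _ _).trans (by linarith)⟩)
    have h2 := abs_le.1 (hr ‖a - b‖ ⟨norm_nonneg _, (norm_sub_le _ _).trans (by linarith)⟩)
    have h3 := abs_le.1 (hr ‖a‖ ⟨norm_nonneg _, by linarith⟩)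
    have h4 := abs_le.1 (hr ‖b‖ ⟨norm_nonneg _, by linarith⟩)
    have hp := parallelogram_law_with_norm 𝕜 a b
    have h5 : 1 ≤ ‖a‖ ^ r + ‖b‖ ^ r := by
      have hA : 0 ≤ ‖a‖ ^ r := Real.rpow_nonneg (norm_nonneg _) _
      have hB : 0 ≤ ‖b‖ ^ r := Real.rpow_nonneg (norm_nonneg _) _
      rcases max_choice ‖a‖ ‖b‖ with h | h <;> rw [h] at hab <;> rw [hab, Real.one_rpow]
      · linarith
      · linarith
    have h6 : ε ≤ ε * (‖a‖ ^ r + ‖b‖ ^ r) := le_mul_of_one_le_right hε.le h5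
    rw [abs_le]
    constructor <;> linarith
  rcases (le_max_of_le_left (norm_nonneg a) : 0 ≤ max ‖a‖ ‖b‖).eq_or_lt with h0 | h0
  · have ha : a = 0 := norm_le_zero_iff.1 (h0 ▸ le_max_left _ _)
    have hb : b = 0 := norm_le_zero_iff.1 (h0 ▸ le_max_right _ _)
    simp [ha, hb, Real.zero_rpow hr0.ne']
  set m := max ‖a‖ ‖b‖
  have hs : ∀ c : 𝕜, ‖((m⁻¹ : ℝ) : 𝕜) * c‖ = m⁻¹ * ‖c‖ := fun c => by
    rw [norm_mul, RCLike.norm_ofReal, abs_of_pos (inv_pos.2 h0)]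
  have hsr : ∀ c : 𝕜, ‖((m⁻¹ : ℝ) : 𝕜) * c‖ ^ r = (m⁻¹) ^ r * ‖c‖ ^ r := fun c => by
    rw [hs, Real.mul_rpow (by positivity) (norm_nonneg _)]
  have h := key (((m⁻¹ : ℝ) : 𝕜) * a) (((m⁻¹ : ℝ) : 𝕜) * b) (by
    rw [hs, hs, ← mul_max_of_nonneg _ _ (inv_nonneg.2 h0.le), inv_mul_cancel₀ h0.ne'])
  rw [← mul_add, ← mul_sub, hsr, hsr, hsr, hsr] at h
  have hm : 0 < (m⁻¹) ^ r := Real.rpow_pos_of_pos (inv_pos.2 h0) _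
  rw [show (m⁻¹) ^ r * ‖a + b‖ ^ r + (m⁻¹) ^ r * ‖a - b‖ ^ r - 2 * ((m⁻¹) ^ r * ‖a‖ ^ r) -
      2 * ((m⁻¹) ^ r * ‖b‖ ^ r) = (m⁻¹) ^ r * (‖a + b‖ ^ r + ‖a - b‖ ^ r - 2 * ‖a‖ ^ r -
      2 * ‖b‖ ^ r) by ring, abs_mul, abs_of_pos hm, ← mul_add, mul_left_comm] at h
  exact le_of_mul_le_mul_left h hm

end RpowEstimates

/-- A dominated convergence theorem for sums, with an error term of small mass and a tail
controlled uniformly off finite sets. -/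
theorem tendsto_tsum_zero_of_dominated {ι : Type*} {I : Type*} {l : Filter I} {G a : I → ι → ℝ}
    {M : ℝ}
    (ha0 : ∀ k i, 0 ≤ a k i) (ha : ∀ k, Summable (a k)) (haM : ∀ k, ∑' i, a k i ≤ M)
    (hG : ∀ i, Tendsto (fun k => G k i) l (𝓝 0))
    (hb : ∀ ε : ℝ, 0 < ε → ∃ b : ι → ℝ, (∀ i, 0 ≤ b i) ∧ Summable b ∧
      ∀ᶠ i in cofinite, ∀ k, |G k i| ≤ ε * a k i + b i) :
    Tendsto (fun k => ∑' i, G k i) l (𝓝 0) := by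
  classical
  rw [tendsto_zero_iff_abs_tendsto_zero]
  refine tendsto_order.2 ⟨fun r hr => Eventually.of_forall fun k => hr.trans_le (abs_nonneg _),
    fun η hη => ?_⟩
  have hM1 : 0 < |M| + 1 := by positivity
  obtain ⟨b, hb0, hbs, hbG⟩ := hb (η / (3 * (|M| + 1))) (by positivity)
  obtain ⟨F, hF⟩ := ((tendsto_tsum_compl_atTop_zero b).eventually_lt_const
    (show 0 < η / 3 by positivity)).exists_forall_of_atTop
  -- Outside `F'` the domination holds and `b` has small total mass; inside, finitely many terms
  -- tend to `0` one by one.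
  set F' := F ∪ (show Set.Finite _ from hbG).toFinset
  have hGF : ∀ k, ∀ i ∉ F', |G k i| ≤ η / (3 * (|M| + 1)) * a k i + b i := fun k i hi => by
    by_contra h
    refine hi (Finset.mem_union_right _ ?_)
    rw [Set.Finite.mem_toFinset]
    exact fun h' => h (h' k)
  have hfin : Tendsto (fun k => ∑ i ∈ F', |G k i|) l (𝓝 0) := by
    simpa using tendsto_finsetSum F' fun i _ => (hG i).abs
  filter_upwards [hfin.eventually_lt_const (show 0 < η / 3 by positivity)] with k hk
  have hmaj : Summable fun i : ((F' : Set ι)ᶜ : Set ι) => η / (3 * (|M| + 1)) * a k i + b i :=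
    (((ha k).mul_left _).add hbs).subtype _
  have hGs' : Summable fun i : ((F' : Set ι)ᶜ : Set ι) => |G k i| :=
    Summable.of_nonneg_of_le (fun _ => abs_nonneg _)
      (fun i => hGF k i (fun h => i.2 (Finset.mem_coe.2 h))) hmaj
  have hGs : Summable fun i => |G k i| := by
    exact (Finset.summable_compl_iff F').1 hGs'
  have h1 : ∑' i : ((F' : Set ι)ᶜ : Set ι), |G k i| ≤
      η / (3 * (|M| + 1)) * ∑' i, a k i + η / 3 := by
    calc ∑' i : ((F' : Set ι)ᶜ : Set ι), |G k i|
        ≤ ∑' i : ((F' : Set ι)ᶜ : Set ι), (η / (3 * (|M| + 1)) * a k i + b i) :=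
          hGs'.tsum_le_tsum (fun i => hGF k i (fun h => i.2 (Finset.mem_coe.2 h))) hmaj
      _ = η / (3 * (|M| + 1)) * ∑' i : ((F' : Set ι)ᶜ : Set ι), a k i +
          ∑' i : ((F' : Set ι)ᶜ : Set ι), b i := by
          rw [← tsum_mul_left]
          exact Summable.tsum_add (((ha k).subtype _).mul_left _) (hbs.subtype _)
      _ ≤ _ := by
          refine add_le_add (mul_le_mul_of_nonneg_left ?_ (by positivity)) ?_
          · exact (ha k).tsum_subtype_le (a k) _ (ha0 k)
          · exact (hF F' Finset.subset_union_left).le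
  have h2 : η / (3 * (|M| + 1)) * ∑' i, a k i ≤ η / 3 := by
    calc η / (3 * (|M| + 1)) * ∑' i, a k i ≤ η / (3 * (|M| + 1)) * (|M| + 1) := by
          refine mul_le_mul_of_nonneg_left ?_ (by positivity)
          linarith [haM k, le_abs_self M]
      _ = η / 3 := by field_simp
  have h3 : |∑' i, G k i| ≤ ∑' i, |G k i| := by
    have := norm_tsum_le_tsum_norm (f := G k) hGs
    exact this
  rw [← hGs.sum_add_tsum_compl (s := F')] at h3
  change |∑' i, G k i| < η
  linarith

/-! ### Null families: their modulars become Hilbertian in the limit. -/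

namespace NakanoExponents

open ConvexModular

variable {𝕜 : Type u} [RCLike 𝕜] {ι : Type v} {q : NakanoExponents ι} {I : Type w}

/-- A family of vectors of a Nakano space is null along a filter if all its coordinates tend
to `0`. -/
def IsNull (l : Filter I) (z : I → q.Nakano 𝕜) : Prop :=
  ∀ i, Tendsto (fun k => coord i (z k)) l (𝓝 0)

theorem IsNull.add {l : Filter I} {z z' : I → q.Nakano 𝕜} (h : IsNull l z) (h' : IsNull l z') :
    IsNull l fun k => z k + z' k := fun i => by
  simpa using (h i).add (h' i)

theorem IsNull.smul {l : Filter I} {z : I → q.Nakano 𝕜} (h : IsNull l z) (c : 𝕜) :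
    IsNull l fun k => c • z k := fun i => by
  simpa using (h i).const_mul c

theorem tendsto_rpow_coord_zero {l : Filter I} {f : I → 𝕜} (h : Tendsto f l (𝓝 0))
    {r : ℝ} (hr : 0 < r) : Tendsto (fun k => ‖f k‖ ^ r) l (𝓝 0) := by
  simpa [Real.zero_rpow hr.ne'] using tendsto_rpow_coord h hr

/-- By Brezis–Lieb each term is at most `ε` times that of `z k`, whose sum is bounded, plus a
multiple of that of `u`, which is summable and independent of `k`. -/
theorem IsNull.tendsto_energy_add_sub {l : Filter I} {z : I → q.Nakano 𝕜} (hz : IsNull l z)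
    {M : ℝ} (hM : ∀ k, energy (z k) ≤ M) (u : q.Nakano 𝕜) :
    Tendsto (fun k => energy (u + z k) - energy (z k) - energy u) l (𝓝 0) := by
  obtain ⟨P, hP⟩ := q.exists_nat_bound
  have h : ∀ k, energy (u + z k) - energy (z k) - energy u =
      ∑' i, (‖coord i u + coord i (z k)‖ ^ q i - ‖coord i (z k)‖ ^ q i - ‖coord i u‖ ^ q i) :=
    fun k => by
      have hs : Summable fun i => ‖coord i u + coord i (z k)‖ ^ q i := by
        simpa using summable_coord (u + z k)
      rw [(hs.sub (summable_coord (z k))).tsum_sub (summable_coord u),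
        hs.tsum_sub (summable_coord (z k))]
      simp only [energy_eq, map_add]
  simp_rw [h]
  refine tendsto_tsum_zero_of_dominated (a := fun k i => ‖coord i (z k)‖ ^ q i)
    (fun k i => term_nonneg _ _) (fun k => summable_coord _) hM (fun i => ?_) fun ε hε => ?_
  · have h1 := tendsto_rpow_coord (tendsto_const_nhds.add (hz i) : Tendsto
      (fun k => coord i u + coord i (z k)) l (𝓝 (coord i u + 0))) (q.pos i)
    have h2 := tendsto_rpow_coord_zero (hz i) (q.pos i)
    simpa using (h1.sub h2).sub_const (‖coord i u‖ ^ q i)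
  · obtain ⟨C, hC, hCe⟩ := exists_abs_rpow_norm_add_sub_le (𝕜 := 𝕜) P hε
    exact ⟨fun i => C * ‖coord i u‖ ^ q i, fun i => mul_nonneg hC (term_nonneg _ _),
      (summable_coord u).mul_left C, Eventually.of_forall fun i k =>
        hCe (q i) (q.one_le' i) (hP i) _ _⟩

/-- Off a finite set of indices `t ^ q i` is within `ε` of `t ^ 2`, and the finitely many remaining
coordinates vanish in the limit. -/
theorem IsNull.tendsto_energy_smul_sub (hq : Tendsto q cofinite (𝓝 2)) {l : Filter I}
    {z : I → q.Nakano 𝕜} (hz : IsNull l z)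
    {M : ℝ} (hM : ∀ k, energy (z k) ≤ M) {t : ℝ} (ht : 0 < t) :
    Tendsto (fun k => energy ((t : 𝕜) • z k) - t ^ 2 * energy (z k)) l (𝓝 0) := by
  have h : ∀ k, energy ((t : 𝕜) • z k) - t ^ 2 * energy (z k) =
      ∑' i, (t ^ q i - t ^ 2) * ‖coord i (z k)‖ ^ q i := fun k => by
    have h1 : ∀ i, ‖coord i ((t : 𝕜) • z k)‖ ^ q i = t ^ q i * ‖coord i (z k)‖ ^ q i := fun i => by
      rw [map_smul, norm_smul, RCLike.norm_ofReal, abs_of_pos ht,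
        Real.mul_rpow ht.le (norm_nonneg _)]
    have hs := summable_coord ((t : 𝕜) • z k)
    simp only [h1] at hs
    simp only [energy_eq, h1]
    rw [← tsum_mul_left, ← hs.tsum_sub ((summable_coord (z k)).mul_left _)]
    exact tsum_congr fun i => (sub_mul _ _ _).symm
  simp_rw [h]
  refine tendsto_tsum_zero_of_dominated (a := fun k i => ‖coord i (z k)‖ ^ q i)
    (fun k i => term_nonneg _ _) (fun k => summable_coord _) hM (fun i => ?_) fun ε hε => ?_
  · simpa using (tendsto_rpow_coord_zero (hz i) (q.pos i)).const_mul (t ^ q i - t ^ 2)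
  · refine ⟨fun _ => 0, fun _ => le_rfl, summable_zero, ?_⟩
    filter_upwards [hq.eventually (eventually_abs_rpow_sub_sq_le t hε)] with i hi k
    rw [add_zero, abs_mul, abs_of_nonneg (term_nonneg _ _)]
    exact mul_le_mul_of_nonneg_right (hi t ⟨ht.le, le_rfl⟩) (term_nonneg _ _)

/-- The approximate parallelogram law for exponents near `2` is summed over all but finitely many
coordinates. This is the source of the inner product on the null part of an ultrapower. -/
theorem IsNull.tendsto_parallelogram (hq : Tendsto q cofinite (𝓝 2)) {l : Filter I}
    {z z' : I → q.Nakano 𝕜} (hz : IsNull l z) (hz' : IsNull l z')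
    {M M' : ℝ} (hM : ∀ k, energy (z k) ≤ M) (hM' : ∀ k, energy (z' k) ≤ M') :
    Tendsto (fun k => energy (z k + z' k) + energy (z k - z' k) - 2 * energy (z k) -
      2 * energy (z' k)) l (𝓝 0) := by
  have h : ∀ k, energy (z k + z' k) + energy (z k - z' k) - 2 * energy (z k) -
      2 * energy (z' k) = ∑' i, (‖coord i (z k) + coord i (z' k)‖ ^ q i +
        ‖coord i (z k) - coord i (z' k)‖ ^ q i - 2 * ‖coord i (z k)‖ ^ q i -
        2 * ‖coord i (z' k)‖ ^ q i) := fun k => by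
    have hs := summable_coord (z k + z' k)
    have hs' := summable_coord (z k - z' k)
    simp only [energy_eq, map_add, map_sub] at hs hs' ⊢
    have h1 := (summable_coord (z k)).mul_left 2
    have h2 := (summable_coord (z' k)).mul_left 2
    rw [((hs.add hs').sub h1).tsum_sub h2, (hs.add hs').tsum_sub h1, hs.tsum_add hs',
      tsum_mul_left, tsum_mul_left]
  simp_rw [h]
  refine tendsto_tsum_zero_of_dominated
    (a := fun k i => ‖coord i (z k)‖ ^ q i + ‖coord i (z' k)‖ ^ q i) (M := M + M')
    (fun k i => add_nonneg (term_nonneg _ _) (term_nonneg _ _))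
    (fun k => (summable_coord _).add (summable_coord _))
    (fun k => ?_) (fun i => ?_) fun ε hε => ?_
  · rw [(summable_coord _).tsum_add (summable_coord _)]
    exact add_le_add (hM k) (hM' k)
  · have h1 := tendsto_rpow_coord_zero (by simpa using (hz i).add (hz' i)) (q.pos i)
    have h2 := tendsto_rpow_coord_zero (by simpa using (hz i).sub (hz' i)) (q.pos i)
    have h3 := (tendsto_rpow_coord_zero (hz i) (q.pos i)).const_mul 2
    have h4 := (tendsto_rpow_coord_zero (hz' i) (q.pos i)).const_mul 2
    simpa using ((h1.add h2).sub h3).sub h4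
  · refine ⟨fun _ => 0, fun _ => le_rfl, summable_zero, ?_⟩
    filter_upwards [hq.eventually (eventually_abs_parallelogram_le (𝕜 := 𝕜) hε)] with i hi k
    rw [add_zero]
    exact hi _ _

/-- Along an ultrafilter, the modulars of a bounded null family tend to the square of the limit
of its norms. -/
theorem IsNull.tendsto_energy (hq : Tendsto q cofinite (𝓝 2)) {U : Ultrafilter I}
    {z : I → q.Nakano 𝕜} (hz : IsNull U z) {M : ℝ} (hM : ∀ k, energy (z k) ≤ M) {c : ℝ}
    (hc : Tendsto (fun k => ‖z k‖) U (𝓝 c)) :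
    Tendsto (fun k => energy (z k)) U (𝓝 (c ^ 2)) := by
  obtain ⟨C, hC, hCl⟩ := (isCompact_Icc (a := 0) (b := M)).ultrafilter_le_nhds
    (U.map fun k => energy (z k))
    (le_principal_iff.2 (mem_map.2 (univ_mem' fun k => ⟨energy_nonneg _, hM k⟩)))
  have hCl' : Tendsto (fun k => energy (z k)) U (𝓝 C) := hCl
  -- If the modulars tend to `C`, then at scale `t` they tend to `t ^ 2 * C`, like those of the
  -- scalar `√C` under the modular `‖·‖ ^ 2`. So the norms tend to `√C`, and `C = c ^ 2`.
  have hn : Tendsto (fun k => ‖z k‖) U (𝓝 ‖toSq 𝕜 ((Real.sqrt C : ℝ) : 𝕜)‖) :=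
    tendsto_norm_of_tendsto_energy fun t ht => by
      rw [smul_toSq, energy_toSq, norm_smul, RCLike.norm_ofReal, RCLike.norm_ofReal, mul_pow,
        sq_abs, sq_abs, Real.sq_sqrt hC.1]
      have h := (hz.tendsto_energy_smul_sub hq hM ht).add (hCl'.const_mul (t ^ 2))
      rw [zero_add] at h
      exact h.congr fun k => by ring
  rw [norm_toSq, RCLike.norm_ofReal, abs_of_nonneg (Real.sqrt_nonneg _)] at hn
  rw [tendsto_nhds_unique hc hn, Real.sq_sqrt hC.1]
  exact hCl'

theorem IsNull.tendsto_energy_smul_add (hq : Tendsto q cofinite (𝓝 2)) {U : Ultrafilter I}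
    {z : I → q.Nakano 𝕜} (hz : IsNull U z) {M : ℝ} (hM : ∀ k, energy (z k) ≤ M) {c : ℝ}
    (hc : Tendsto (fun k => ‖z k‖) U (𝓝 c)) (u : q.Nakano 𝕜) {t : ℝ} (ht : 0 < t) :
    Tendsto (fun k => energy ((t : 𝕜) • (u + z k))) U
      (𝓝 (energy ((t : 𝕜) • u) + t ^ 2 * c ^ 2)) := by
  obtain ⟨P, hP⟩ := q.exists_nat_bound
  have h1 := (hz.tendsto_energy_smul_sub hq hM ht).add ((hz.tendsto_energy hq hM hc).const_mul
    (t ^ 2))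
  have hb : ∀ k, energy ((t : 𝕜) • z k) ≤ (max t 1) ^ P * M := fun k => by
    have hle : (max t 1) ^ P * energy (z k) ≤ (max t 1) ^ P * M := by
      have := hM k
      gcongr
    refine le_trans ?_ hle
    rcases le_total t 1 with h1 | h1
    · rw [max_eq_right h1, one_pow, one_mul]
      exact (energy_smul_le _ ht.le h1).trans (mul_le_of_le_one_left (energy_nonneg _) h1)
    · rw [max_eq_left h1]
      exact doubling hP t _ h1
  have h2 := (((hz.smul (t : 𝕜)).tendsto_energy_add_sub hb ((t : 𝕜) • u)).add h1).const_add
    (energy ((t : 𝕜) • u))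
  simp only [zero_add] at h2
  refine h2.congr fun k => ?_
  rw [smul_add]
  ring

/-- The norm of a translate of a null family. -/
theorem IsNull.tendsto_norm_add (hq : Tendsto q cofinite (𝓝 2)) {U : Ultrafilter I}
    {z : I → q.Nakano 𝕜} (hz : IsNull U z) {M : ℝ} (hM : ∀ k, energy (z k) ≤ M) {c : ℝ}
    (hc : Tendsto (fun k => ‖z k‖) U (𝓝 c)) (u : q.Nakano 𝕜) :
    Tendsto (fun k => ‖u + z k‖) U (𝓝 ‖pair u (toSq 𝕜 (c : 𝕜))‖) :=
  tendsto_norm_of_tendsto_energy fun t ht => by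
    rw [smul_pair, energy_pair, smul_toSq, energy_toSq, norm_smul, RCLike.norm_ofReal,
      RCLike.norm_ofReal, mul_pow, sq_abs, sq_abs]
    exact hz.tendsto_energy_smul_add hq hM hc u ht

/-- A weak Banach–Saks property: a closed subspace containing a translate of a bounded null family
contains the translation vector. -/
theorem IsNull.mem_of_forall_add_mem (hq : Tendsto q cofinite (𝓝 2)) {U : Ultrafilter I}
    {z : I → q.Nakano 𝕜} (hz : IsNull U z) {M : ℝ} (hM : ∀ k, energy (z k) ≤ M) {c : ℝ}
    (hc : Tendsto (fun k => ‖z k‖) U (𝓝 c)) {R : Submodule 𝕜 (q.Nakano 𝕜)}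
    (hR : IsClosed (R : Set (q.Nakano 𝕜))) {y : q.Nakano 𝕜} (hy : ∀ k, y + z k ∈ R) : y ∈ R := by
  obtain ⟨P, hP⟩ := q.exists_nat_bound
  -- Greedy choice: each new `z k` is taken along `U` so that it raises the modular at scale `t` by
  -- at most `t ^ 2 * (c ^ 2 + 1)`. The modular thus grows only linearly in the number of summands.
  have step : ∀ t : ℝ, 0 < t → ∀ n : ℕ, ∃ w : q.Nakano 𝕜, (n : 𝕜) • y + w ∈ R ∧
      energy ((t : 𝕜) • w) ≤ n * (t ^ 2 * (c ^ 2 + 1)) := fun t ht n => by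
    induction n with
    | zero => exact ⟨0, by simp, by simp⟩
    | succ n ih =>
      obtain ⟨w, hw, hwe⟩ := ih
      have h := (hz.tendsto_energy_smul_add hq hM hc w ht).eventually_lt_const
        (show energy ((t : 𝕜) • w) + t ^ 2 * c ^ 2 < energy ((t : 𝕜) • w) + t ^ 2 * (c ^ 2 + 1) by
          have : 0 < t ^ 2 := by positivity
          linarith)
      obtain ⟨k, hk⟩ := h.exists
      refine ⟨w + z k, ?_, ?_⟩
      · have := R.add_mem hw (hy k)
        rw [Nat.cast_succ, add_smul, one_smul, add_add_add_comm]
        exact this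
      · push_cast
        linarith
  -- With `n + 1` summands and scale `t = (n + 1)⁻¹`, the averages lie in `R` and miss `y` by a
  -- vector of modular at most `(c ^ 2 + 1) / (n + 1)`.
  choose w hw hwe using fun n : ℕ => step ((n + 1 : ℝ)⁻¹) (by positivity) (n + 1)
  have h0 : Tendsto (fun n : ℕ => energy ((((n + 1 : ℝ)⁻¹ : ℝ) : 𝕜) • w n)) atTop (𝓝 0) := by
    refine squeeze_zero (fun _ => energy_nonneg _) (g := fun n : ℕ => (c ^ 2 + 1) * (1 / (n + 1 : ℝ)))
      (fun n => (hwe n).trans_eq ?_) ?_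
    · push_cast
      field_simp
    · have h := (tendsto_one_div_add_atTop_nhds_zero_nat (𝕜 := ℝ)).const_mul (c ^ 2 + 1)
      rwa [mul_zero] at h
  have h1 := (doubling hP).tendsto_zero h0
  have h2 := h1.const_add y
  rw [add_zero] at h2
  refine hR.mem_of_tendsto h2 (Eventually.of_forall fun n => ?_)
  have h3 := R.smul_mem (((n + 1 : ℝ)⁻¹ : ℝ) : 𝕜) (hw n)
  have h4 : (((n + 1 : ℝ)⁻¹ : ℝ) : 𝕜) * ((n + 1 : ℕ) : 𝕜) = 1 := by
    have h5 : ((n : 𝕜) + 1) ≠ 0 := by exact_mod_cast Nat.succ_ne_zero n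
    push_cast
    exact inv_mul_cancel₀ h5
  rwa [smul_add, smul_smul, h4, one_smul] at h3

end NakanoExponents

/-! ### Banach space ultrapowers. -/

namespace BanachUltrapower

variable {𝕜 : Type w} [RCLike 𝕜] {X : Type u} [NormedAddCommGroup X] [NormedSpace 𝕜 X]
  {I : Type v} {U : Ultrafilter I}

/-- The bounded family with given members. -/
noncomputable def family (f : I → X) {R : ℝ} (hf : ∀ k, ‖f k‖ ≤ R) : lp (fun _ : I => X) ∞ :=
  ⟨f, memℓp_infty ⟨R, by rintro _ ⟨k, rfl⟩; exact hf k⟩⟩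

variable (𝕜 U) in
/-- The class of a bounded family in the ultrapower. -/
noncomputable def cls (f : lp (fun _ : I => X) ∞) : BanachUltrapower 𝕜 X U := (nullFamilies 𝕜 X U).mkQ f

theorem exists_cls (w : BanachUltrapower 𝕜 X U) : ∃ f, cls 𝕜 U f = w :=
  (nullFamilies 𝕜 X U).mkQ_surjective w

theorem cls_add (f g : lp (fun _ : I => X) ∞) : cls 𝕜 U (f + g) = cls 𝕜 U f + cls 𝕜 U g :=
  map_add _ f g

theorem cls_sub (f g : lp (fun _ : I => X) ∞) : cls 𝕜 U (f - g) = cls 𝕜 U f - cls 𝕜 U g :=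
  map_sub _ f g

theorem cls_smul (c : 𝕜) (f : lp (fun _ : I => X) ∞) : cls 𝕜 U (c • f) = c • cls 𝕜 U f :=
  map_smul (nullFamilies 𝕜 X U).mkQ c f

theorem norm_apply_le (f : lp (fun _ : I => X) ∞) (k : I) : ‖f k‖ ≤ ‖f‖ :=
  lp.norm_apply_le_norm ENNReal.top_ne_zero f k

theorem cls_eq_cls {f g : lp (fun _ : I => X) ∞} :
    cls 𝕜 U f = cls 𝕜 U g ↔ Tendsto (fun k => f k - g k) U (𝓝 0) := by
  rw [← sub_eq_zero, ← cls_sub]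
  exact Submodule.Quotient.mk_eq_zero (nullFamilies 𝕜 X U)

/-- The norm of an ultrapower is the limit of the norms. -/
theorem tendsto_norm_cls (f : lp (fun _ : I => X) ∞) :
    Tendsto (fun k => ‖f k‖) U (𝓝 ‖cls 𝕜 U f‖) := by
  classical
  obtain ⟨c, hc, hcl⟩ := (isCompact_Icc (a := 0) (b := ‖f‖)).ultrafilter_le_nhds
    (U.map fun k => ‖f k‖)
    (le_principal_iff.2 (mem_map.2 (univ_mem' fun k => ⟨norm_nonneg _, norm_apply_le f k⟩)))
  have hcl' : Tendsto (fun k => ‖f k‖) U (𝓝 c) := hcl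
  suffices h : ‖cls 𝕜 U f‖ = c by rwa [h]
  refine le_antisymm (le_of_forall_pos_le_add fun ε hε => ?_)
    (le_of_forall_pos_le_add fun ε hε => ?_)
  -- Replacing the entries of norm above `c + ε` by `0` keeps the class and gives a representative
  -- of supremum norm at most `c + ε`.
  · have hg : ∀ k, ‖if ‖f k‖ ≤ c + ε then f k else 0‖ ≤ c + ε := fun k => by
      split_ifs with h
      · exact h
      · rw [norm_zero]; linarith [hc.1]
    have h1 : cls 𝕜 U f = cls 𝕜 U (family _ hg) := by
      refine cls_eq_cls.2 (tendsto_const_nhds.congr' ?_)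
      filter_upwards [hcl'.eventually_lt_const (show c < c + ε by linarith)] with k hk
      change 0 = f k - (if ‖f k‖ ≤ c + ε then f k else 0)
      rw [if_pos hk.le, sub_self]
    rw [h1]
    refine (Submodule.Quotient.norm_mk_le _ _).trans ?_
    exact lp.norm_le_of_forall_le (by linarith [hc.1]) hg
  · obtain ⟨m, hm, hmn⟩ := Submodule.Quotient.norm_mk_lt (S := nullFamilies 𝕜 X U) (cls 𝕜 U f) hε
    have h1 : Tendsto (fun k => f k - m k) U (𝓝 0) := cls_eq_cls.1 hm.symm
    have h2 := h1.norm.add_const ‖m‖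
    rw [norm_zero, zero_add] at h2
    refine (le_of_tendsto_of_tendsto hcl' h2 (Eventually.of_forall fun k => ?_)).trans hmn.le
    calc ‖f k‖ = ‖(f k - m k) + m k‖ := by rw [sub_add_cancel]
      _ ≤ ‖f k - m k‖ + ‖m k‖ := norm_add_le _ _
      _ ≤ ‖f k - m k‖ + ‖m‖ := by gcongr; exact norm_apply_le m k

/-- The constant family. -/
noncomputable def const (I : Type v) (x : X) : lp (fun _ : I => X) ∞ := family (fun _ => x) fun _ => le_rfl

variable (𝕜 X U) in
/-- The diagonal embedding of a space in its ultrapower. -/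
noncomputable def diag : X →ₗᵢ[𝕜] BanachUltrapower 𝕜 X U where
  toFun x := cls 𝕜 U (const I x)
  map_add' x y := by rw [← cls_add]; rfl
  map_smul' c x := by rw [RingHom.id_apply, ← cls_smul]; rfl
  norm_map' x := tendsto_nhds_unique (tendsto_norm_cls (𝕜 := 𝕜) (U := U) (const I x))
    (tendsto_const_nhds (x := ‖x‖))

theorem diag_apply (x : X) : diag 𝕜 X U x = cls 𝕜 U (const I x) := rfl

/-- Bounded families converge along `U` by local compactness, so the diagonal embedding is onto.
This excludes finite dimensional ultraroots. -/
theorem finiteDimensional [FiniteDimensional 𝕜 X] :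
    FiniteDimensional 𝕜 (BanachUltrapower 𝕜 X U) := by
  have := FiniteDimensional.proper_rclike 𝕜 X
  refine Module.Finite.of_surjective (diag 𝕜 X U).toLinearMap fun w => ?_
  obtain ⟨f, rfl⟩ := exists_cls w
  obtain ⟨x, -, hx⟩ := (isCompact_closedBall (0 : X) ‖f‖).ultrafilter_le_nhds
    (U.map fun k => f k)
    (le_principal_iff.2 (mem_map.2 (univ_mem' fun k => by simpa using norm_apply_le f k)))
  have hx' : Tendsto (fun k => f k) U (𝓝 x) := hx
  refine ⟨x, (cls_eq_cls.2 ?_).symm⟩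
  have := hx'.sub_const x
  rwa [sub_self] at this

end BanachUltrapower

/-! ### Splitting an ultrapower into its diagonal and null parts. -/

namespace ConvexModular

variable {𝕜 : Type u} [RCLike 𝕜]

theorem norm_eq_of_energy_eq {X : Type*} [AddCommGroup X] [Module 𝕜 X] {Y : Type*}
    [AddCommGroup Y] [Module 𝕜 Y] {Θ : ConvexModular 𝕜 X} {Ψ : ConvexModular 𝕜 Y}
    {x : Θ.Space} {y : Ψ.Space}
    (h : ∀ t : ℝ, 0 < t → energy ((t : 𝕜) • x) = energy ((t : 𝕜) • y)) : ‖x‖ = ‖y‖ :=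
  tendsto_nhds_unique (tendsto_const_nhds (f := (atTop : Filter ℕ)))
    (tendsto_norm_of_tendsto_energy (x := fun _ : ℕ => x) fun t ht => by
      rw [h t ht]; exact tendsto_const_nhds)

end ConvexModular

namespace NakanoExponents

open ConvexModular BanachUltrapower

variable {𝕜 : Type} [RCLike 𝕜] {ι : Type v} {q : NakanoExponents ι} {X : Type u}
  [NormedAddCommGroup X] [NormedSpace 𝕜 X] (D : X →ₗᵢ[𝕜] q.Nakano 𝕜)
  {I : Type w} (U : Ultrafilter I)

/-- The classes of the bounded families whose image in the Nakano space is null. -/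
def nullPart : Submodule 𝕜 (BanachUltrapower 𝕜 X U) where
  carrier := {w | ∃ f, cls 𝕜 U f = w ∧ IsNull U fun k => D (f k)}
  zero_mem' := ⟨0, map_zero (nullFamilies 𝕜 X U).mkQ, fun i => by simp⟩
  add_mem' := by
    rintro _ _ ⟨f, rfl, hf⟩ ⟨g, rfl, hg⟩
    refine ⟨f + g, cls_add f g, ?_⟩
    simpa using hf.add hg
  smul_mem' := by
    rintro c _ ⟨f, rfl, hf⟩
    refine ⟨c • f, cls_smul c f, ?_⟩
    simpa using hf.smul c

variable {D U}

theorem tendsto_norm_map_cls (f : lp (fun _ : I => X) ∞) :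
    Tendsto (fun k => ‖D (f k)‖) U (𝓝 ‖cls 𝕜 U f‖) := by
  simpa using tendsto_norm_cls (𝕜 := 𝕜) (U := U) f

theorem exists_energy_map_bound (f : lp (fun _ : I => X) ∞) :
    ∃ M, 0 ≤ M ∧ ∀ k, energy (D (f k)) ≤ M :=
  exists_energy_bound (R := ‖f‖) fun k => by simpa using norm_apply_le f k

/-- A null class enters only through its norm, as a scalar in a one-dimensional Hilbert summand.
Since only a subspace `X` of the Nakano space is needed, the formula also serves for ultraroots. -/
theorem norm_diag_add_cls (hq : Tendsto q cofinite (𝓝 2)) {f : lp (fun _ : I => X) ∞}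
    (hf : IsNull U fun k => D (f k)) (x : X) :
    ‖diag 𝕜 X U x + cls 𝕜 U f‖ = ‖pair (D x) (toSq 𝕜 ((‖cls 𝕜 U f‖ : ℝ) : 𝕜))‖ := by
  obtain ⟨M, -, hM⟩ := exists_energy_map_bound (D := D) f
  have h1 := hf.tendsto_norm_add hq hM (tendsto_norm_map_cls f) (D x)
  have h2 := tendsto_norm_map_cls (D := D) (U := U) (const I x + f)
  rw [diag_apply, ← cls_add]
  refine tendsto_nhds_unique h2 (h1.congr fun k => ?_)
  rw [← map_add]
  rfl

/-- Every element of an ultrapower of a closed subspace of a Nakano space is the sum of a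
diagonal element and of the class of a null family. -/
theorem exists_diag_add_cls [CompleteSpace X] (hq : Tendsto q cofinite (𝓝 2))
    (w : BanachUltrapower 𝕜 X U) :
    ∃ (x : X) (f : lp (fun _ : I => X) ∞), w = diag 𝕜 X U x + cls 𝕜 U f ∧
      IsNull U fun k => D (f k) := by
  obtain ⟨g, rfl⟩ := exists_cls w
  obtain ⟨y, hy⟩ := exists_limit U (x := fun k => D (g k)) (R := ‖g‖)
    fun k => by simpa using norm_apply_le g k
  have hb : ∀ k, ‖D (g k) - y‖ ≤ ‖g‖ + ‖y‖ := fun k => (norm_sub_le _ _).trans (by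
    gcongr
    simpa using norm_apply_le g k)
  have hz : IsNull U fun k => D (g k) - y := fun i => by
    simpa using (hy i).sub_const (coord i y)
  obtain ⟨M, -, hM⟩ := exists_energy_bound hb
  obtain ⟨c, -, hc⟩ := (isCompact_Icc (a := 0) (b := ‖g‖ + ‖y‖)).ultrafilter_le_nhds
    (U.map fun k => ‖D (g k) - y‖)
    (le_principal_iff.2 (mem_map.2 (univ_mem' fun k => ⟨norm_nonneg _, hb k⟩)))
  -- The coordinatewise limit a priori lies only in the ambient Nakano space; the Banach–Saks
  -- property brings it back into the closed copy of `X`.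
  have hmem := hz.mem_of_forall_add_mem hq hM hc (R := LinearMap.range D.toLinearMap) (y := y)
    (by
      have := D.isometry.isClosedEmbedding.isClosed_range
      exact this) fun k => ⟨g k, by simp⟩
  obtain ⟨x, rfl⟩ := hmem
  refine ⟨x, g - const I x, ?_, ?_⟩
  · rw [cls_sub, diag_apply, add_sub_cancel]
  · refine fun i => (hz i).congr fun k => ?_
    change coord i (D (g k) - D x) = coord i (D (g k - x))
    rw [map_sub D]

theorem isClosed_nullPart : IsClosed (nullPart D U : Set (BanachUltrapower 𝕜 X U)) := by
  refine isClosed_of_closure_subset fun w hw => ?_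
  obtain ⟨f, rfl⟩ := exists_cls w
  refine ⟨f, rfl, fun i => ?_⟩
  rw [Metric.tendsto_nhds]
  intro ε hε
  obtain ⟨_, ⟨g, rfl, hg⟩, hfg⟩ := Metric.mem_closure_iff.1 hw (ε / 2) (half_pos hε)
  rw [dist_eq_norm, ← cls_sub] at hfg
  filter_upwards [Metric.tendsto_nhds.1 (hg i) (ε / 2) (half_pos hε),
    (tendsto_norm_map_cls (D := D) (f - g)).eventually_lt_const hfg] with k h1 h2
  rw [dist_zero_right] at h1 ⊢
  have h3 := (norm_coord_le i (D ((f - g) k))).trans_lt h2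
  calc ‖coord i (D (f k))‖ = ‖coord i (D ((f - g) k)) + coord i (D (g k))‖ := by
        rw [← map_add, ← map_add]
        congr 3
        simp
    _ ≤ ‖coord i (D ((f - g) k))‖ + ‖coord i (D (g k))‖ := norm_add_le _ _
    _ < ε := by linarith

/-- The squared norm of a null class is the limit of the modulars, so the asymptotic parallelogram
law becomes exact. -/
theorem parallelogram_nullPart (hq : Tendsto q cofinite (𝓝 2)) (v v' : nullPart D U) :
    ‖v + v'‖ * ‖v + v'‖ + ‖v - v'‖ * ‖v - v'‖ = 2 * (‖v‖ * ‖v‖ + ‖v'‖ * ‖v'‖) := by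
  obtain ⟨_, f, rfl, hf⟩ := v
  obtain ⟨_, g, rfl, hg⟩ := v'
  change ‖cls 𝕜 U f + cls 𝕜 U g‖ * ‖cls 𝕜 U f + cls 𝕜 U g‖ +
    ‖cls 𝕜 U f - cls 𝕜 U g‖ * ‖cls 𝕜 U f - cls 𝕜 U g‖ =
    2 * (‖cls 𝕜 U f‖ * ‖cls 𝕜 U f‖ + ‖cls 𝕜 U g‖ * ‖cls 𝕜 U g‖)
  have key : ∀ h : lp (fun _ : I => X) ∞, (IsNull U fun k => D (h k)) →
      Tendsto (fun k => energy (D (h k))) U (𝓝 (‖cls 𝕜 U h‖ ^ 2)) := fun h hh => by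
    obtain ⟨M, -, hM⟩ := exists_energy_map_bound (D := D) h
    exact hh.tendsto_energy hq hM (tendsto_norm_map_cls h)
  have hs : IsNull U fun k => D ((f + g) k) := by simpa using hf.add hg
  have hd : IsNull U fun k => D ((f - g) k) := by
    simpa [sub_eq_add_neg] using hf.add (hg.smul (-1))
  obtain ⟨M, -, hM⟩ := exists_energy_map_bound (D := D) f
  obtain ⟨M', -, hM'⟩ := exists_energy_map_bound (D := D) g
  have h1 := hf.tendsto_parallelogram hq hg hM hM'
  have h2 := (((key _ hs).add (key _ hd)).sub ((key f hf).const_mul 2)).sub ((key g hg).const_mul 2)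
  have h3 := tendsto_nhds_unique (h2.congr fun k => by simp) h1
  rw [← cls_add, ← cls_sub]
  linarith

/-- The ultrapower of a Nakano space whose exponents tend to `2` is the modular direct sum of the
space and of its null part. -/
theorem exists_isometryEquiv_nullPart (hq : Tendsto q cofinite (𝓝 2)) (e : X ≃ₗᵢ[𝕜] q.Nakano 𝕜) :
    Nonempty (BanachUltrapower 𝕜 X U ≃ₗᵢ[𝕜]
      ((q.modular 𝕜).sum (normSq 𝕜 (nullPart e.toLinearIsometry U))).Space) := by
  have : CompleteSpace X := e.toIsometryEquiv.completeSpace_iff.2 inferInstance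
  let K := nullPart e.toLinearIsometry U
  let L : ((q.modular 𝕜).sum (normSq 𝕜 K)).Space →ₗᵢ[𝕜] BanachUltrapower 𝕜 X U :=
    { toFun := fun z => diag 𝕜 X U (e.symm (show q.Nakano 𝕜 from z.1)) + (show K from z.2)
      map_add' := fun z z' => by
        have h1 := map_add e.symm (show q.Nakano 𝕜 from z.1) (show q.Nakano 𝕜 from z'.1)
        have h2 := map_add (diag 𝕜 X U) (e.symm (show q.Nakano 𝕜 from z.1))
          (e.symm (show q.Nakano 𝕜 from z'.1))
        rw [← h1] at h2
        exact (congrArg₂ (· + ·) h2 (Submodule.coe_add (show K from z.2)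
          (show K from z'.2))).trans (add_add_add_comm _ _ _ _)
      map_smul' := fun c z => by
        have h1 := map_smul e.symm c (show q.Nakano 𝕜 from z.1)
        have h2 := map_smul (diag 𝕜 X U) c (e.symm (show q.Nakano 𝕜 from z.1))
        rw [← h1] at h2
        exact (congrArg₂ (· + ·) h2 (Submodule.coe_smul c (show K from z.2))).trans
          (smul_add _ _ _).symm
      norm_map' := fun z => by
        obtain ⟨y, ⟨_, f, rfl, hf⟩⟩ := z
        refine (norm_diag_add_cls hq hf (e.symm y)).trans (norm_eq_of_energy_eq fun t ht => ?_)
        rw [smul_pair, energy_pair, smul_toSq, energy_toSq]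
        refine (congrArg₂ (· + ·) (congrArg (fun s : q.Nakano 𝕜 => energy ((t : 𝕜) • s))
          (e.apply_symm_apply y)) (congrArg (· ^ 2) ?_))
        rw [norm_smul, RCLike.norm_ofReal (‖_‖), abs_of_nonneg (norm_nonneg _), ← norm_smul]
        rfl }
  refine ⟨(LinearIsometryEquiv.ofSurjective L fun w => ?_).symm⟩
  obtain ⟨x, f, rfl, hf⟩ := exists_diag_add_cls (D := e.toLinearIsometry) hq w
  refine ⟨pair (e x) (toSq 𝕜 (⟨cls 𝕜 U f, f, rfl, hf⟩ : K)), ?_⟩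
  change diag 𝕜 X U (e.symm (e x)) + cls 𝕜 U f = _
  rw [e.symm_apply_apply]

end NakanoExponents

/-! ### Ultraroots: recovering the modular and the unit vectors. -/

namespace NakanoExponents

open ConvexModular BanachUltrapower

section Ultraroots

variable {𝕜 : Type} [RCLike 𝕜] {ι : Type v} {q : NakanoExponents ι} {X : Type u}
  [NormedAddCommGroup X] [NormedSpace 𝕜 X] {I : Type w} {U : Ultrafilter I}

/-- An infinite dimensional subspace of a Nakano space contains a normalized null family. -/
theorem exists_normalized_null (hX : ¬ FiniteDimensional 𝕜 X) (D : X →ₗᵢ[𝕜] q.Nakano 𝕜) :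
    ∃ (V : Ultrafilter (Finset ι)) (ξ : Finset ι → X), (∀ F, ‖ξ F‖ = 1) ∧
      IsNull V fun F => D (ξ F) := by
  have h : ∀ F : Finset ι, ∃ x : X, ‖x‖ = 1 ∧ ∀ i ∈ F, coord i (D x) = 0 := fun F => by
    -- Evaluation at finitely many coordinates has a kernel on an infinite dimensional space;
    -- normalized kernel vectors, indexed by `F`, form a null family.
    let L : X →ₗ[𝕜] (F → 𝕜) :=
      LinearMap.pi fun i => (coord (i : ι)).comp D.toLinearMap
    have hL : ¬ Function.Injective L := fun hL => hX (FiniteDimensional.of_injective L hL)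
    rw [injective_iff_map_eq_zero] at hL
    push Not at hL
    obtain ⟨x, hx, hx0⟩ := hL
    refine ⟨((‖x‖⁻¹ : ℝ) : 𝕜) • x, ?_, fun i hi => ?_⟩
    · rw [norm_smul, RCLike.norm_ofReal, abs_of_nonneg (by positivity),
        inv_mul_cancel₀ (norm_ne_zero_iff.2 hx0)]
    · have h1 : coord i (D x) = 0 := congrFun hx ⟨i, hi⟩
      rw [map_smul, map_smul, h1, smul_zero]
  choose ξ hξ hξ0 using h
  refine ⟨Ultrafilter.of atTop, ξ, hξ, fun i => ?_⟩
  refine Tendsto.mono_left (tendsto_const_nhds.congr' ?_) (Ultrafilter.of_le atTop)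
  filter_upwards [eventually_ge_atTop {i}] with F hF
  exact (hξ0 F i (hF (Finset.mem_singleton_self i))).symm

/-- The modular of a Nakano space is determined by its norm; it is additive on the decomposition
of an ultrapower into its diagonal and null parts. -/
theorem energy_map_diag_add (hq : Tendsto q cofinite (𝓝 2)) (hX : ¬ FiniteDimensional 𝕜 X)
    (T : BanachUltrapower 𝕜 X U ≃ₗᵢ[𝕜] q.Nakano 𝕜) (x : X) {f : lp (fun _ : I => X) ∞}
    (hf : IsNull U fun k => T (diag 𝕜 X U (f k)))
    (hle : energy (T (diag 𝕜 X U x + cls 𝕜 U f)) ≤ 1) :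
    energy (T (diag 𝕜 X U x + cls 𝕜 U f)) =
      energy (T (diag 𝕜 X U x)) + ‖cls 𝕜 U f‖ ^ 2 := by
  obtain ⟨P, hP⟩ := q.exists_nat_bound
  let D : X →ₗᵢ[𝕜] q.Nakano 𝕜 := T.toLinearIsometry.comp (diag 𝕜 X U)
  obtain ⟨V, ξ, hξ, hξ0⟩ := exists_normalized_null hX D
  set y := T (diag 𝕜 X U x + cls 𝕜 U f) with hy
  set c := ‖cls 𝕜 U f‖
  -- This is the mass missing from `y`: adding null vectors of norm `s` brings it to the unit sphere
  -- in the limit, where norm `1` and modular `1` coincide.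
  set s := Real.sqrt (1 - energy y)
  have hs : s ^ 2 = 1 - energy y := Real.sq_sqrt (by linarith)
  have hs0 : 0 ≤ s := Real.sqrt_nonneg _
  have hnull : IsNull V fun F => D ((s : 𝕜) • ξ F) := by simpa using hξ0.smul (s : 𝕜)
  have hnorm : ∀ F, ‖D ((s : 𝕜) • ξ F)‖ = s := fun F => by
    rw [D.norm_map, norm_smul, hξ, RCLike.norm_ofReal, abs_of_nonneg hs0, mul_one]
  have hlim : Tendsto (fun F => ‖D ((s : 𝕜) • ξ F)‖) V (𝓝 s) := by
    simp only [hnorm]; exact tendsto_const_nhds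
  obtain ⟨M, -, hM⟩ := exists_energy_bound (x := fun F => D ((s : 𝕜) • ξ F)) (R := s)
    fun F => (hnorm F).le
  have h1 := hnull.tendsto_norm_add hq hM hlim y
  have hone : ‖pair y (toSq 𝕜 (s : 𝕜))‖ = 1 := norm_eq_one_of_energy_eq_one (by
    rw [energy_pair, energy_toSq, RCLike.norm_ofReal, sq_abs, hs]; ring)
  have h2 : Tendsto (fun F => ‖pair (D x + D ((s : 𝕜) • ξ F)) (toSq 𝕜 (c : 𝕜))‖) V
      (𝓝 ‖pair (pair (D x) (toSq 𝕜 (c : 𝕜))) (toSq 𝕜 (s : 𝕜))‖) :=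
    tendsto_norm_of_tendsto_energy fun t ht => by
      simp only [smul_pair, energy_pair, smul_toSq, energy_toSq]
      have h3 := (hnull.tendsto_energy_smul_add hq hM hlim (D x) ht).add_const
        (‖(t : 𝕜) • (c : 𝕜)‖ ^ 2)
      convert h3 using 2
      rw [norm_smul (t : 𝕜) (s : 𝕜), RCLike.norm_ofReal, RCLike.norm_ofReal, mul_pow, sq_abs,
        sq_abs]
      ring
  -- The added vectors come from the diagonal, so they join `x` and leave the null class untouched.
  -- The same norms are thereby computed in a second way.
  have h4 : ∀ F, ‖pair (D x + D ((s : 𝕜) • ξ F)) (toSq 𝕜 (c : 𝕜))‖ =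
      ‖y + D ((s : 𝕜) • ξ F)‖ := fun F => by
    have h5 := norm_diag_add_cls (D := D) hq hf (x + (s : 𝕜) • ξ F)
    rw [D.map_add] at h5
    rw [← h5, hy, ← T.norm_map, map_add (diag 𝕜 X U), add_right_comm, map_add T]
    rfl
  have h6 := tendsto_nhds_unique (h2.congr h4) h1
  have h7 := (((doubling hP).sum doubling_normSq).sum doubling_normSq).energy_eq_one
    (h6.trans hone)
  rw [energy_pair, energy_pair, energy_toSq, energy_toSq, RCLike.norm_ofReal, RCLike.norm_ofReal,
    sq_abs, sq_abs, hs] at h7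
  change energy y = energy (D x) + c ^ 2
  linarith

/-- If an ultrapower of `X` is a Nakano space with exponents tending to `2`, then the unit vectors
with exponents different from `2` come from `X`. -/
theorem exists_map_diag_eq_unit [CompleteSpace X] (hq : Tendsto q cofinite (𝓝 2))
    (hX : ¬ FiniteDimensional 𝕜 X) (T : BanachUltrapower 𝕜 X U ≃ₗᵢ[𝕜] q.Nakano 𝕜) {i : ι}
    (hi : q i ≠ 2) : ∃ x : X, T (diag 𝕜 X U x) = unit i := by
  obtain ⟨x, f, hxf, hf⟩ := exists_diag_add_cls (D := T.toLinearIsometry.comp (diag 𝕜 X U)) hq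
    (T.symm (unit i))
  replace hf : IsNull U fun k => T (diag 𝕜 X U (f k)) := hf
  have hT : T (diag 𝕜 X U x) + T (cls 𝕜 U f) = unit i := by
    rw [← map_add T, ← hxf, T.apply_symm_apply]
  set a := T (diag 𝕜 X U x) with ha
  set b := T (cls 𝕜 U f) with hb
  set c := ‖cls 𝕜 U f‖ with hc
  suffices h0 : c = 0 by
    refine ⟨x, ?_⟩
    have : b = 0 := by rw [hb, norm_eq_zero.1 h0, map_zero]
    rw [this, add_zero] at hT
    exact hT
  have hsm : ∀ (t : ℝ) (x' : X), 0 < t → energy ((t : 𝕜) • (T (diag 𝕜 X U x') + b)) ≤ 1 →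
      energy ((t : 𝕜) • (T (diag 𝕜 X U x') + b)) =
        energy ((t : 𝕜) • T (diag 𝕜 X U x')) + t ^ 2 * c ^ 2 := fun t x' ht hle => by
    have hn : IsNull U fun k => T (diag 𝕜 X U (((t : 𝕜) • f) k)) := by
      simpa using hf.smul (t : 𝕜)
    have h1 : (t : 𝕜) • (T (diag 𝕜 X U x') + b) =
        T (diag 𝕜 X U ((t : 𝕜) • x') + cls 𝕜 U ((t : 𝕜) • f)) := by
      rw [cls_smul, map_smul (diag 𝕜 X U), ← smul_add, map_smul T, map_add T]
    have h2 := energy_map_diag_add hq hX T ((t : 𝕜) • x') hn (by rw [← h1]; exact hle)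
    rw [← h1, cls_smul, norm_smul, RCLike.norm_ofReal, abs_of_pos ht, mul_pow,
      map_smul (diag 𝕜 X U), map_smul T] at h2
    exact h2
  -- As `a = unit i - b`, the coordinates of `a` and `b` off `i` have equal norms. Subtracting the
  -- modular identities for `unit i = a + b` and for `b` alone cancels them, and only the `i`-th
  -- coordinates, collected in `A`, remain.
  set A : ℝ := 1 - ‖1 - coord i b‖ ^ q i + ‖coord i b‖ ^ q i
  have hA : ∀ t : ℝ, 0 < t → t ≤ 1 → t * energy b ≤ 1 → t ^ q i * A = 2 * (t ^ 2 * c ^ 2) := by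
    intro t ht ht1 htb
    have e1 := hsm t x ht (by
      rw [← ha, hT, energy_smul_unit, RCLike.norm_ofReal, abs_of_pos ht]
      exact Real.rpow_le_one ht.le ht1 (q.pos i).le)
    have e2 := hsm t 0 ht (by
      rw [map_zero, map_zero, zero_add]
      exact (energy_smul_le _ ht.le ht1).trans htb)
    rw [← ha, hT, energy_smul_unit, RCLike.norm_ofReal, abs_of_pos ht] at e1
    rw [map_zero, map_zero, zero_add, smul_zero, energy_zero, zero_add] at e2
    have hab : a = unit i - b := eq_sub_of_add_eq hT
    have hr0 : coord i ((t : 𝕜) • (b - coord i b • unit i)) = 0 := by simp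
    have hpow : ∀ d : 𝕜, ‖(t : 𝕜) * d‖ ^ q i = t ^ q i * ‖d‖ ^ q i := fun d => by
      rw [norm_mul, RCLike.norm_ofReal, abs_of_pos ht, Real.mul_rpow ht.le (norm_nonneg _)]
    have e3 := energy_eq_add ((t : 𝕜) • b) i hr0 fun j hj => by simp [coord_unit_of_ne hj]
    have e4 := energy_eq_add ((t : 𝕜) • a) i hr0 fun j hj => by
      simp [hab, coord_unit_of_ne hj]
    rw [map_smul, smul_eq_mul, hpow] at e3 e4
    rw [hab, map_sub, coord_unit_self, ← hab] at e4
    simp only [A]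
    linarith
  -- A scale small enough for the modulars of both vectors to stay in the unit range where
  -- additivity is known.
  set t := (1 + energy b)⁻¹
  have hb0 := energy_nonneg b
  have ht : 0 < t := by positivity
  have ht1 : t ≤ 1 := inv_le_one_of_one_le₀ (by linarith)
  have htb : t * energy b ≤ 1 := by
    rw [inv_mul_le_iff₀ (by positivity)]; linarith
  have h1 := hA t ht ht1 htb
  -- Comparing the scales `t` and `t / 2` gives `2⁻¹ ^ q i = 2⁻¹ ^ 2` unless `c = 0`.
  have h2 := hA (2⁻¹ * t) (by positivity) (by linarith) (by nlinarith)
  rw [Real.mul_rpow (by norm_num) ht.le, mul_assoc, h1] at h2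
  by_contra hc0
  have h3 : t ^ 2 * c ^ 2 ≠ 0 := by positivity
  have h4 : (2⁻¹ : ℝ) ^ q i = 2⁻¹ ^ (2 : ℝ) := by
    rw [Real.rpow_two]
    have : (2⁻¹ : ℝ) ^ q i * (t ^ 2 * c ^ 2) = 2⁻¹ ^ 2 * (t ^ 2 * c ^ 2) := by linarith
    exact mul_right_cancel₀ h3 this
  exact hi ((Real.rpow_right_inj (by norm_num) (by norm_num)).1 h4)

end Ultraroots

end NakanoExponents

/-! ### Modular direct sums under isometries and for intermediate subspaces. -/

namespace ConvexModular

variable {𝕜 : Type} [RCLike 𝕜] {Y : Type v} [AddCommGroup Y] [Module 𝕜 Y]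
  (Θ : ConvexModular 𝕜 Y)

/-- Isometric embeddings of normed spaces extend to modular direct sums. -/
def sumMap {H H' : Type*} [NormedAddCommGroup H] [NormedSpace 𝕜 H] [NormedAddCommGroup H']
    [NormedSpace 𝕜 H'] (j : H →ₗᵢ[𝕜] H') :
    (Θ.sum (normSq 𝕜 H)).Space →ₗᵢ[𝕜] (Θ.sum (normSq 𝕜 H')).Space where
  toFun z := pair z.1 (toSq 𝕜 (j z.2))
  map_add' z z' := congrArg (pair (Θ := Θ) (Ψ := normSq 𝕜 H') _) (map_add j z.2 z'.2)
  map_smul' c z := congrArg (pair (Θ := Θ) (Ψ := normSq 𝕜 H') _) (map_smul j c z.2)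
  norm_map' z := norm_eq_of_energy_eq fun t ht =>
    congrArg (energy (Θ := Θ) ((t : 𝕜) • (z.1 : Θ.Space)) + ·) (congrArg (· ^ 2) (by
      change ‖(t : 𝕜) • j z.2‖ = ‖(t : 𝕜) • (show H from z.2)‖
      rw [norm_smul, norm_smul, j.norm_map]))

/-- Isometric normed spaces have isometric modular direct sums. -/
noncomputable def sumCongr {H H' : Type*} [NormedAddCommGroup H] [NormedSpace 𝕜 H]
    [NormedAddCommGroup H'] [NormedSpace 𝕜 H'] (e : H ≃ₗᵢ[𝕜] H') :
    (Θ.sum (normSq 𝕜 H)).Space ≃ₗᵢ[𝕜] (Θ.sum (normSq 𝕜 H')).Space :=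
  LinearIsometryEquiv.ofSurjective (Θ.sumMap e.toLinearIsometry) fun z =>
    ⟨pair z.1 (toSq 𝕜 (e.symm z.2)),
      congrArg (pair (Θ := Θ) (Ψ := normSq 𝕜 H') _) (e.apply_symm_apply z.2)⟩

/-- The embedding of the second summand in a modular direct sum. -/
def sumInr (H : Type*) [NormedAddCommGroup H] [NormedSpace 𝕜 H] :
    H →ₗᵢ[𝕜] (Θ.sum (normSq 𝕜 H)).Space where
  toFun h := pair 0 (toSq 𝕜 h)
  map_add' h h' := congrArg (pair (Θ := Θ) (Ψ := normSq 𝕜 H) · _) (add_zero 0).symm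
  map_smul' c h := congrArg (pair (Θ := Θ) (Ψ := normSq 𝕜 H) · _) (smul_zero c).symm
  norm_map' h := by
    have key : ‖pair (0 : Θ.Space) (toSq 𝕜 h)‖ = ‖toSq 𝕜 h‖ := norm_eq_of_energy_eq fun t ht => by
      rw [smul_pair, energy_pair, smul_zero, energy_zero, zero_add]
    exact key.trans (norm_toSq h)

/-- A complete space that embeds in a modular direct sum `Y ⊕_m H` with a range that contains `Y`
is itself a modular direct sum of `Y` with a closed subspace of `H`. -/
theorem exists_submodule_of_range {X : Type*} [NormedAddCommGroup X] [NormedSpace 𝕜 X]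
    [CompleteSpace X] {H : Type*} [NormedAddCommGroup H] [NormedSpace 𝕜 H]
    (D : X →ₗᵢ[𝕜] (Θ.sum (normSq 𝕜 H)).Space)
    (hD : ∀ y : Θ.Space, ∃ x, D x = pair y (toSq 𝕜 0)) :
    ∃ K : Submodule 𝕜 H, IsClosed (K : Set H) ∧
      Nonempty (X ≃ₗᵢ[𝕜] (Θ.sum (normSq 𝕜 K)).Space) := by
  let K : Submodule 𝕜 H := (LinearMap.range D.toLinearMap).comap (Θ.sumInr H).toLinearMap
  have hcl : IsClosed (LinearMap.range D.toLinearMap : Set (Θ.sum (normSq 𝕜 H)).Space) :=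
    D.isometry.isClosedEmbedding.isClosed_range
  refine ⟨K, hcl.preimage (Θ.sumInr H).continuous, ?_⟩
  let L := Θ.sumMap K.subtypeₗᵢ
  have hdec : ∀ (y : Θ.Space) (h : H), pair y (toSq 𝕜 h) =
      pair y (toSq 𝕜 (0 : H)) + Θ.sumInr H h := fun y h =>
    Prod.ext (add_zero y).symm (zero_add h).symm
  have hr : LinearMap.range D.toLinearMap = LinearMap.range L.toLinearMap := by
    ext z
    constructor
    · intro hz
      have hz2 : (show H from z.2) ∈ K := by
        have h1 := hdec z.1 z.2
        obtain ⟨x, hx⟩ := hD z.1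
        have h2 : Θ.sumInr H z.2 = z - D x := by
          rw [hx]
          exact eq_sub_of_add_eq' h1.symm
        change Θ.sumInr H z.2 ∈ LinearMap.range D.toLinearMap
        rw [h2]
        exact Submodule.sub_mem _ hz ⟨x, rfl⟩
      exact ⟨pair z.1 (toSq 𝕜 (⟨z.2, hz2⟩ : K)), rfl⟩
    · rintro ⟨z, rfl⟩
      obtain ⟨x, hx⟩ := hD z.1
      have h1 : L z = D x + Θ.sumInr H ((show K from z.2) : H) := by
        rw [hx]
        exact hdec z.1 ((show K from z.2) : H)
      have h2 : Θ.sumInr H ((show K from z.2) : H) ∈ LinearMap.range D.toLinearMap :=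
        (show K from z.2).2
      change L z ∈ _
      rw [h1]
      exact Submodule.add_mem _ ⟨x, rfl⟩ h2
  exact ⟨D.equivRange.trans ((LinearIsometryEquiv.ofEq _ _ hr).trans L.equivRange.symm)⟩

end ConvexModular

/-! ### Hilbert summands as families of exponents equal to `2`. -/

namespace NakanoExponents

open ConvexModular BanachUltrapower

variable {𝕜 : Type} [RCLike 𝕜] {ι : Type v}

/-- Reindexing a Nakano space. -/
noncomputable def reindex {κ : Type w} {q : NakanoExponents ι} {q' : NakanoExponents κ}
    (e : ι ≃ κ) (h : ∀ i, q' (e i) = q i) : q.Nakano 𝕜 ≃ₗᵢ[𝕜] q'.Nakano 𝕜 :=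
  isometryOfEnergy
    { toFun := fun x => ⟨fun k => x.1 (e.symm k), by
        have hx : Summable fun i => ‖x.1 i‖ ^ q i := x.2
        refine ((e.symm.summable_iff).2 hx).congr fun k => ?_
        simp [← h]⟩
      map_add' := fun _ _ => rfl
      map_smul' := fun _ _ => rfl
      invFun := fun x => ⟨fun i => x.1 (e i), by
        have hx : Summable fun k => ‖x.1 k‖ ^ q' k := x.2
        refine ((e.summable_iff).2 hx).congr fun k => ?_
        simp [← h]⟩
      left_inv := fun x => Subtype.ext (funext fun i => by simp)
      right_inv := fun x => Subtype.ext (funext fun i => by simp) }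
    fun x => by
      change ∑' k, ‖x.1 (e.symm k)‖ ^ q' k = ∑' i, ‖x.1 i‖ ^ q i
      rw [← e.tsum_eq]
      simp [h]

/-- Adding a family of exponents equal to `2`. -/
def withTwo (q : NakanoExponents ι) (B : Type w) : NakanoExponents (ι ⊕ B) where
  toFun := Sum.elim q fun _ => 2
  one_le' := by
    rintro (i | b)
    · exact q.one_le' i
    · exact one_le_two
  bddAbove' := by
    obtain ⟨M, hM⟩ := q.bddAbove'
    refine ⟨max M 2, ?_⟩
    rintro _ ⟨i | b, rfl⟩
    · exact le_max_of_le_left (hM ⟨i, rfl⟩)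
    · exact le_max_right _ _

variable {q : NakanoExponents ι}

/-- Indices with exponent `2` lie in the preimage of every neighbourhood of `2`. With convergence
along `cofinite`, index sets of any size are thus covered by the same hypothesis as sequences. -/
theorem tendsto_withTwo (hq : Tendsto q cofinite (𝓝 2)) (B : Type w) :
    Tendsto (q.withTwo B) cofinite (𝓝 2) := by
  refine tendsto_def.2 fun s hs => ?_
  rw [mem_cofinite]
  refine ((mem_cofinite.1 (tendsto_def.1 hq s hs)).image Sum.inl).subset ?_
  rintro (i | b) hi
  · exact ⟨i, hi, rfl⟩
  · exact absurd (mem_of_mem_nhds hs) hi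

theorem summable_rpow_two_iff {B : Type w} {f : B → 𝕜} :
    Memℓp f 2 ↔ Summable fun b => ‖f b‖ ^ (2 : ℝ) := by
  rw [memℓp_gen_iff (by norm_num)]
  norm_num

theorem summable_withTwo_iff {B : Type w} {f : ι ⊕ B → 𝕜} :
    (Summable fun i => ‖f i‖ ^ q.withTwo B i) ↔
      (Summable fun i => ‖f (Sum.inl i)‖ ^ q i) ∧ Memℓp (fun b => f (Sum.inr b)) 2 := by
  rw [summable_rpow_two_iff]
  refine ⟨fun h => ⟨h.comp_injective Sum.inl_injective, h.comp_injective Sum.inr_injective⟩,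
    fun h => ?_⟩
  exact (HasSum.sum (f := fun i => ‖f i‖ ^ q.withTwo B i) h.1.hasSum h.2.hasSum).summable

/-- Splitting off the coordinates with the added exponents. -/
def withTwoLinearEquiv (q : NakanoExponents ι) (B : Type w) :
    (q.withTwo B).carrier 𝕜 ≃ₗ[𝕜] q.carrier 𝕜 × lp (fun _ : B => 𝕜) 2 where
  toFun x := (⟨fun i => x.1 (Sum.inl i), (summable_withTwo_iff.1 x.2).1⟩,
    ⟨fun b => x.1 (Sum.inr b), (summable_withTwo_iff.1 x.2).2⟩)
  map_add' _ _ := rfl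
  map_smul' _ _ := rfl
  invFun z := ⟨Sum.elim z.1.1 z.2.1, summable_withTwo_iff.2 ⟨z.1.2, z.2.2⟩⟩
  left_inv x := Subtype.ext (funext fun i => by cases i <;> rfl)
  right_inv _ := rfl

/-- Adding exponents equal to `2` amounts to adding a Hilbert space. -/
noncomputable def withTwoEquiv (q : NakanoExponents ι) (B : Type w) :
    (q.withTwo B).Nakano 𝕜 ≃ₗᵢ[𝕜]
      ((q.modular 𝕜).sum (normSq 𝕜 (lp (fun _ : B => 𝕜) 2))).Space :=
  isometryOfEnergy (q.withTwoLinearEquiv B) fun x => by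
    have hx : Summable fun i => ‖x.1 i‖ ^ q.withTwo B i := x.2
    have h := Summable.tsum_sum (hx.comp_injective Sum.inl_injective)
      (hx.comp_injective Sum.inr_injective)
    refine Eq.trans ?_ h.symm
    have h2 := lp.norm_rpow_eq_tsum (p := 2) (by norm_num) (q.withTwoLinearEquiv B x).2
    rw [ENNReal.toReal_ofNat, Real.rpow_two] at h2
    exact congrArg (∑' i, ‖x.1 (Sum.inl i)‖ ^ q i + ·) h2

/-- A modular direct sum of a Nakano space with a Hilbert space is a Nakano space. -/
theorem exists_withTwo_equiv (q : NakanoExponents ι) (H : Type u) [NormedAddCommGroup H]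
    [InnerProductSpace 𝕜 H] [CompleteSpace H] :
    ∃ B : Type u, Nonempty (H ≃ₗᵢ[𝕜] lp (fun _ : B => 𝕜) 2) ∧
      Nonempty (((q.modular 𝕜).sum (normSq 𝕜 H)).Space ≃ₗᵢ[𝕜] (q.withTwo B).Nakano 𝕜) := by
  obtain ⟨w, b, -⟩ := exists_hilbertBasis 𝕜 H
  exact ⟨w, ⟨b.repr⟩, ⟨(sumCongr _ b.repr).trans (q.withTwoEquiv w).symm⟩⟩

/-- An ultrapower of a Nakano space with exponents tending to `2` is obtained by adding exponents
equal to `2`. -/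
theorem exists_ultrapower_equiv {ι : Type*} {q : NakanoExponents ι} (hq : Tendsto q cofinite (𝓝 2)) {B : Type w} {X : Type u}
    [NormedAddCommGroup X] [NormedSpace 𝕜 X] (e : X ≃ₗᵢ[𝕜] (q.withTwo B).Nakano 𝕜) {I : Type v}
    (U : Ultrafilter I) :
    ∃ B' : Type (max u v), Nonempty (BanachUltrapower 𝕜 X U ≃ₗᵢ[𝕜] (q.withTwo (B ⊕ B')).Nakano 𝕜) := by
  have hq' := tendsto_withTwo hq B
  obtain ⟨E⟩ := exists_isometryEquiv_nullPart (U := U) hq' e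
  let K := nullPart e.toLinearIsometry U
  have : CompleteSpace X := e.toIsometryEquiv.completeSpace_iff.2 inferInstance
  let : InnerProductSpace 𝕜 K := InnerProductSpace.ofNorm 𝕜 (parallelogram_nullPart hq')
  have : CompleteSpace K := isClosed_nullPart.completeSpace_coe
  obtain ⟨B', -, ⟨E'⟩⟩ := (q.withTwo B).exists_withTwo_equiv (𝕜 := 𝕜) K
  refine ⟨B', ⟨(E.trans E').trans (reindex (Equiv.sumAssoc ι B B') ?_)⟩⟩
  rintro ((i | b) | b) <;> rfl

/-- If an ultrapower of an infinite dimensional Banach space `X` is a modular direct sum of a Nakano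
space, with exponents different from `2` and tending to `2`, and of a Hilbert space, then so
is `X`. -/
theorem exists_ultraroot_equiv (hq : Tendsto q cofinite (𝓝 2)) (hq2 : ∀ i, q i ≠ 2) {B : Type u}
    {X : Type u} [NormedAddCommGroup X] [NormedSpace 𝕜 X] [CompleteSpace X]
    (hX : ¬ FiniteDimensional 𝕜 X) {I : Type w} {U : Ultrafilter I}
    (T : BanachUltrapower 𝕜 X U ≃ₗᵢ[𝕜] (q.withTwo B).Nakano 𝕜) :
    ∃ (H : Type u) (_ : NormedAddCommGroup H) (_ : InnerProductSpace 𝕜 H), CompleteSpace H ∧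
      Nonempty (X ≃ₗᵢ[𝕜] ((q.modular 𝕜).sum (normSq 𝕜 H)).Space) := by
  have hq' := tendsto_withTwo hq B
  let D : X →ₗᵢ[𝕜] (q.withTwo B).Nakano 𝕜 := T.toLinearIsometry.comp (diag 𝕜 X U)
  have hcl : IsClosed (LinearMap.range D.toLinearMap : Set ((q.withTwo B).Nakano 𝕜)) :=
    D.isometry.isClosedEmbedding.isClosed_range
  have hunit : ∀ i, (unit (Sum.inl i) : (q.withTwo B).Nakano 𝕜) ∈ LinearMap.range D.toLinearMap :=
    fun i => exists_map_diag_eq_unit hq' hX T (hq2 i)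
  obtain ⟨K, hK, hE⟩ := exists_submodule_of_range (q.modular 𝕜)
    ((q.withTwoEquiv B).toLinearIsometry.comp D) fun y => by
      set z := (q.withTwoEquiv (𝕜 := 𝕜) B).symm (pair y (toSq 𝕜 0)) with hz
      have hz0 : ∀ b, coord (Sum.inr b) z = 0 := fun b => rfl
      -- `z` is supported on the indices whose unit vectors already lie in the closed range of `D`.
      have hmem : z ∈ LinearMap.range D.toLinearMap :=
        hcl.mem_of_tendsto (tendsto_sum_unit z) (Eventually.of_forall fun F =>
          Submodule.sum_mem _ fun i _ => by
            rcases i with i | b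
            · exact Submodule.smul_mem _ _ (hunit i)
            · rw [hz0, zero_smul]
              exact Submodule.zero_mem _)
      obtain ⟨x, hx⟩ := hmem
      refine ⟨x, ?_⟩
      change q.withTwoEquiv B (D x) = _
      rw [show D x = z from hx, hz, LinearIsometryEquiv.apply_symm_apply]
  have : CompleteSpace K := hK.completeSpace_coe
  exact ⟨K, inferInstance, inferInstance, this, hE⟩

end NakanoExponents

/-! ### Cardinalities of index sets and density characters. -/

theorem exists_injective_of_separated {A : Type*} {E : Type*} [NormedAddCommGroup E] {f : A → E}
    (hf : Pairwise fun a b => 1 ≤ ‖f a - f b‖) {s : Set E} (hs : Dense s) :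
    ∃ g : A → s, Function.Injective g := by
  have h : ∀ a, ∃ x : s, ‖f a - x‖ < 1 / 2 := fun a => by
    obtain ⟨x, hx, hd⟩ := hs.exists_dist_lt (f a) (show (0 : ℝ) < 1 / 2 by norm_num)
    exact ⟨⟨x, hx⟩, by rwa [← dist_eq_norm]⟩
  choose g hg using h
  refine ⟨g, fun a b hab => ?_⟩
  by_contra hne
  have h1 := hf hne
  have h2 : ‖f a - f b‖ ≤ ‖f a - g a‖ + ‖f b - g a‖ := by
    rw [show f a - f b = (f a - g a) - (f b - g a) by abel]
    exact norm_sub_le _ _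
  have h3 := hg a
  have h4 := hg b
  rw [← hab] at h4
  linarith

namespace BanachUltrapower

variable {𝕜 : Type} [RCLike 𝕜] {X : Type v} [NormedAddCommGroup X] [NormedSpace 𝕜 X]

/-- The ultrapower of an infinite dimensional space along a regular ultrafilter on the finite
subsets of `κ` contains `2 ^ κ` separated points. -/
theorem exists_separated (hX : ¬ FiniteDimensional 𝕜 X) (κ : Type u) :
    ∃ f : Set κ → BanachUltrapower 𝕜 X (Ultrafilter.of (atTop : Filter (Finset κ))),
      Pairwise fun A B => 1 ≤ ‖f A - f B‖ := by
  classical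
  obtain ⟨R, x, -, hx, hsep⟩ := exists_seq_norm_le_one_le_norm_sub hX
  -- `code s` numbers the subsets of the finite set `s`, so one term of a separated sequence records
  -- `s ∩ A`. Sets differing at `a` receive different terms as soon as `a ∈ s`.
  let code : Finset κ → Finset κ → ℕ := fun s t =>
    if h : t ∈ s.powerset then (s.powerset.equivFin ⟨t, h⟩ : ℕ) else 0
  have hcode : ∀ s t t' : Finset κ, t ⊆ s → t' ⊆ s → code s t = code s t' → t = t' := by
    intro s t t' ht ht' h
    simp only [code, dif_pos (Finset.mem_powerset.2 ht), dif_pos (Finset.mem_powerset.2 ht')] at h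
    exact congrArg Subtype.val (s.powerset.equivFin.injective (Fin.ext h))
  refine ⟨fun A => cls 𝕜 _ (family (fun s => x (code s (s.filter (· ∈ A)))) fun s => hx _),
    fun A B hAB => ?_⟩
  obtain ⟨a, ha⟩ : ∃ a, ¬ (a ∈ A ↔ a ∈ B) := by
    by_contra! h
    exact hAB (Set.ext h)
  rw [← cls_sub]
  refine ge_of_tendsto (tendsto_norm_cls _) (Ultrafilter.of_le atTop ?_)
  filter_upwards [eventually_ge_atTop {a}] with s hs
  refine hsep fun h => ha ?_
  have h1 := hcode s _ _ (Finset.filter_subset _ _) (Finset.filter_subset _ _) h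
  have h2 := Finset.ext_iff.1 h1 a
  simpa [hs (Finset.mem_singleton_self a)] using h2

end BanachUltrapower

/-- As `κ` is infinite, `Finset κ × κ` has the cardinality of `κ`, so a `Finset κ`-indexed family of
subsets of `κ` can be coded by one subset. This counts the families representing elements of an
ultrapower. -/
theorem exists_injective_finset_pi {κ : Type u} [Infinite κ] {X : Type v} {g : X → Set κ}
    (hg : Function.Injective g) : ∃ h : (Finset κ → X) → Set κ, Function.Injective h := by
  have hc : Cardinal.mk (Finset κ × κ) = Cardinal.mk κ := by
    rw [Cardinal.mk_prod, Cardinal.lift_id, Cardinal.lift_id, Cardinal.mk_finset_of_infinite]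
    exact Cardinal.mul_eq_self (Cardinal.aleph0_le_mk κ)
  obtain ⟨e⟩ := Cardinal.eq.1 hc
  refine ⟨fun f => e '' {z | z.2 ∈ g (f z.1)}, fun f f' h => funext fun s => hg (Set.ext fun a => ?_)⟩
  have h1 := e.injective.image_injective h
  exact Set.ext_iff.1 h1 (s, a)

namespace NakanoExponents

open ConvexModular BanachUltrapower

variable {𝕜 : Type} [RCLike 𝕜] {ι : Type u} {q : NakanoExponents ι}

theorem one_le_norm_unit_sub : Pairwise fun i j =>
    1 ≤ ‖(unit i : q.Nakano 𝕜) - unit j‖ := fun i j hij => by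
  have h := norm_coord_le i ((unit i : q.Nakano 𝕜) - unit j)
  rwa [map_sub, coord_unit_self, coord_unit_of_ne hij, sub_zero, norm_one] at h

/-- The density character of a Nakano space is at most the cardinality of its index set. -/
theorem exists_dense (q : NakanoExponents ι) :
    ∃ s : Set (q.Nakano 𝕜), Dense s ∧
      Nonempty (s ↪ (ι × ℕ →₀ ℤ)) := by
  -- The dense set consists of the integer combinations of unit vectors scaled by a dense sequence
  -- of scalars. Being a subgroup, it has a closure stable under sums.
  let φ : (ι × ℕ →₀ ℤ) →+ q.Nakano 𝕜 := Finsupp.liftAddHom fun z =>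
    (AddMonoidHom.mk' (fun n : ℤ => n • (TopologicalSpace.denseSeq 𝕜 z.2 • (unit z.1 : q.Nakano 𝕜)))
      fun a b => add_smul a b _)
  refine ⟨Set.range φ, ?_, ⟨⟨fun y => y.2.choose, fun y y' h => Subtype.ext ?_⟩⟩⟩
  · have hu : ∀ (i : ι) (c : 𝕜), c • (unit i : q.Nakano 𝕜) ∈ φ.range.topologicalClosure := by
      intro i c
      have hcont : Continuous fun c : 𝕜 => c • (unit i : q.Nakano 𝕜) :=
        continuous_id.smul continuous_const
      have hcl : IsClosed {c : 𝕜 | c • (unit i : q.Nakano 𝕜) ∈ φ.range.topologicalClosure} :=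
        φ.range.isClosed_topologicalClosure.preimage hcont
      refine (TopologicalSpace.denseRange_denseSeq 𝕜).induction_on c hcl fun n => ?_
      refine AddSubgroup.le_topologicalClosure _ ⟨Finsupp.single (i, n) 1, ?_⟩
      simp [φ]
    intro x
    have hx : x ∈ φ.range.topologicalClosure :=
      φ.range.isClosed_topologicalClosure.mem_of_tendsto (tendsto_sum_unit x)
        (Eventually.of_forall fun F => AddSubgroup.sum_mem _ fun i _ => hu i _)
    exact hx
  · have h1 := y.2.choose_spec
    have h2 := y'.2.choose_spec
    have h' : y.2.choose = y'.2.choose := h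
    rw [← h1, ← h2, h']

theorem mk_finsupp_le (ι : Type u) :
    Cardinal.mk (ι × ℕ →₀ ℤ) ≤ max (Cardinal.mk ι) Cardinal.aleph0 := by
  rcases isEmpty_or_nonempty ι with h | h
  · exact le_max_of_le_right (Cardinal.mk_le_aleph0_iff.2 inferInstance)
  · rw [Cardinal.mk_finsupp_lift_of_infinite]
    simp only [Cardinal.mk_prod, Cardinal.lift_uzero, Cardinal.mk_nat, Cardinal.lift_aleph0,
      Cardinal.mk_int, max_le_iff, le_max_right, and_true]
    exact Cardinal.mul_le_of_le (le_max_right _ _) (le_max_left _ _) (le_max_right _ _)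

/-- The cardinality of the index set of a Nakano space that is isometric to a sufficiently regular
ultrapower. -/
theorem mk_eq_of_ultrapower {X : Type v} [NormedAddCommGroup X] [NormedSpace 𝕜 X]
    (hX : ¬ FiniteDimensional 𝕜 X) {κ : Type u} [Infinite κ] {g : X → Set κ}
    (hg : Function.Injective g)
    (T : BanachUltrapower 𝕜 X (Ultrafilter.of (atTop : Filter (Finset κ))) ≃ₗᵢ[𝕜] q.Nakano 𝕜) :
    Cardinal.mk ι = Cardinal.mk (Set κ) := by
  refine le_antisymm ?_ ?_
  · obtain ⟨h, hh⟩ := exists_injective_finset_pi hg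
    choose rep hrep using fun w : BanachUltrapower 𝕜 X
      (Ultrafilter.of (atTop : Filter (Finset κ))) => exists_cls w
    refine Cardinal.mk_le_of_injective (f := fun i => h fun s => rep (T.symm (unit i)) s)
      fun i j hij => ?_
    have h1 : rep (T.symm (unit i)) = rep (T.symm (unit j)) := Subtype.ext (hh hij)
    have h2 : (unit i : q.Nakano 𝕜) = unit j := by
      apply T.symm.injective
      rw [← hrep (T.symm (unit i)), h1, hrep]
    by_contra hne
    have h3 := one_le_norm_unit_sub (𝕜 := 𝕜) (q := q) hne
    change 1 ≤ ‖(unit i : q.Nakano 𝕜) - unit j‖ at h3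
    rw [h2, sub_self, norm_zero] at h3
    exact absurd h3 (by norm_num)
  · obtain ⟨f, hf⟩ := exists_separated hX κ
    obtain ⟨s, hs, ⟨j⟩⟩ := q.exists_dense (𝕜 := 𝕜)
    obtain ⟨k, hk⟩ := exists_injective_of_separated (f := fun A => T (f A))
      (fun A B hAB => by
        change 1 ≤ ‖T (f A) - T (f B)‖
        rw [← map_sub, T.norm_map]
        exact hf hAB) hs
    have h1 := (Cardinal.mk_le_of_injective (j.injective.comp hk)).trans (mk_finsupp_le ι)
    -- By Cantor's theorem a countable dense set has no room for `2 ^ κ` separated points, so the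
    -- `ℵ₀` term cannot be the larger one.
    rcases le_max_iff.1 h1 with h | h
    · exact h
    · rw [Cardinal.mk_set] at h
      exact absurd (h.trans (Cardinal.aleph0_le_mk κ)) (not_le.2 (Cardinal.cantor _))

/-- The density character of a Nakano space is essentially the cardinality of its index set. -/
theorem mk_eq_density {X : BanachSp.{0, u} 𝕜} (e : X ≃ₗᵢ[𝕜] q.Nakano 𝕜) :
    Cardinal.mk ι ≤ X.density ∧ X.density ≤ max (Cardinal.mk ι) Cardinal.aleph0 := by
  constructor
  · refine le_csInf ⟨_, Set.univ, dense_univ, rfl⟩ ?_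
    rintro _ ⟨s, hs, rfl⟩
    obtain ⟨k, hk⟩ := exists_injective_of_separated (f := fun i => e.symm (unit i))
      (fun i j hij => by
        change 1 ≤ ‖e.symm (unit i) - e.symm (unit j)‖
        rw [← map_sub, e.symm.norm_map]
        exact one_le_norm_unit_sub hij) hs
    exact Cardinal.mk_le_of_injective hk
  · obtain ⟨s, hs, ⟨j⟩⟩ := q.exists_dense (𝕜 := 𝕜)
    have hd : Dense (e.symm '' s) :=
      e.symm.surjective.denseRange.dense_image e.symm.continuous hs
    have h : X.density ≤ Cardinal.mk (e.symm '' s) := csInf_le' ⟨_, hd, rfl⟩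
    exact h.trans (Cardinal.mk_image_le.trans
      ((Cardinal.mk_le_of_injective j.injective).trans (mk_finsupp_le ι)))

/-- A Nakano space with countable index set embeds, as a set, in the power set of any infinite
set. -/
theorem exists_injective_set (p : NakanoExponents ℕ) (κ : Type u) [Infinite κ] :
    ∃ g : p.Nakano 𝕜 → Set κ, Function.Injective g := by
  have h1 : Cardinal.mk (ℕ → ℝ × ℝ) = Cardinal.mk (Set ℕ) := by
    simp [Cardinal.mk_real]
  obtain ⟨e⟩ := Cardinal.eq.1 h1
  refine ⟨fun x => Infinite.natEmbedding κ '' e fun n =>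
    (RCLike.re (coord n x), RCLike.im (coord n x)), fun x y h => ext_coord fun n => ?_⟩
  have h2 := congrFun (e.injective
    ((Infinite.natEmbedding κ).injective.image_injective h)) n
  exact RCLike.ext (congrArg Prod.fst h2) (congrArg Prod.snd h2)

end NakanoExponents

/-! ### The elementary class and its uncountable categoricity. -/

namespace NakanoExponents

open ConvexModular BanachUltrapower

theorem linearIndependent_unit {𝕜 : Type u} [RCLike 𝕜] {ι : Type v} {q : NakanoExponents ι} :
    LinearIndependent 𝕜 (unit : ι → q.Nakano 𝕜) := by
  refine linearIndependent_iff'.2 fun s g hg i hi => ?_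
  have h := congrArg (coord i) hg
  rw [map_sum, map_zero, Finset.sum_eq_single_of_mem i hi fun j _ hj => by
    rw [map_smul, coord_unit_of_ne hj.symm, smul_zero], map_smul, coord_unit_self] at h
  simpa using h

theorem finite_of_finiteDimensional {𝕜 : Type u} [RCLike 𝕜] {ι : Type v} {q : NakanoExponents ι}
    (h : FiniteDimensional 𝕜 (q.Nakano 𝕜)) : Finite ι :=
  (linearIndependent_unit (𝕜 := 𝕜) (q := q)).finite

theorem finiteDimensional_of_finite {𝕜 : Type u} [RCLike 𝕜] {ι : Type v} [Finite ι]
    {q : NakanoExponents ι} : FiniteDimensional 𝕜 (q.Nakano 𝕜) :=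
  FiniteDimensional.of_injective (LinearMap.pi fun i => (coord i : q.Nakano 𝕜 →ₗ[𝕜] 𝕜))
    fun _ _ h => ext_coord fun i => congrFun h i

theorem not_finiteDimensional_of_embedding {𝕜 : Type} [RCLike 𝕜] {X : Type u}
    [NormedAddCommGroup X] [NormedSpace 𝕜 X] {Y : Type v} [NormedAddCommGroup Y] [NormedSpace 𝕜 Y]
    (j : X →ₗᵢ[𝕜] Y) (hX : ¬ FiniteDimensional 𝕜 X) : ¬ FiniteDimensional 𝕜 Y := fun _ =>
  hX (FiniteDimensional.of_injective j.toLinearMap j.injective)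

variable {𝕜 : Type} [RCLike 𝕜] {p : NakanoExponents ℕ}

theorem tendsto_nonHilbert (hp : Tendsto (fun n => p n) atTop (𝓝 2)) :
    Tendsto p.nonHilbert cofinite (𝓝 2) := by
  rw [← Nat.cofinite_eq_atTop] at hp
  exact hp.comp Subtype.val_injective.tendsto_cofinite

theorem mk_eq_of_mk_sum {B : Type u} {c : Cardinal.{u}} (hc : Cardinal.aleph0 < c)
    (h : Cardinal.mk ({n : ℕ // p n ≠ 2} ⊕ B) = c) : Cardinal.mk B = c := by
  rw [Cardinal.mk_sum, Cardinal.lift_uzero] at h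
  have h1 : Cardinal.lift.{u} (Cardinal.mk {n : ℕ // p n ≠ 2}) ≤ Cardinal.aleph0 := by
    simp
  have h2 : Cardinal.aleph0 ≤ Cardinal.mk B := by
    by_contra! hB
    exact absurd (h ▸ Cardinal.add_le_aleph0.2 ⟨h1, hB.le⟩) (not_le.2 hc)
  rwa [Cardinal.add_eq_right h2 (h1.trans h2)] at h

/-- Two spaces built on index sets of the same uncountable cardinality are isometric. -/
theorem nonempty_equiv_of_mk_eq {B B' : Type u} {c : Cardinal.{u}} (hc : Cardinal.aleph0 < c)
    (h : Cardinal.mk ({n : ℕ // p n ≠ 2} ⊕ B) = c)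
    (h' : Cardinal.mk ({n : ℕ // p n ≠ 2} ⊕ B') = c) :
    Nonempty ((p.nonHilbert.withTwo B).Nakano 𝕜 ≃ₗᵢ[𝕜] (p.nonHilbert.withTwo B').Nakano 𝕜) := by
  obtain ⟨e⟩ := Cardinal.eq.1 ((mk_eq_of_mk_sum hc h).trans (mk_eq_of_mk_sum hc h').symm)
  refine ⟨reindex (Equiv.sumCongr (Equiv.refl _) e) ?_⟩
  rintro (i | b) <;> rfl

/-- A sequence of exponents, split into those that differ from `2` and those equal to `2`. -/
theorem nonempty_nakano_equiv (p : NakanoExponents ℕ) :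
    Nonempty (p.Nakano 𝕜 ≃ₗᵢ[𝕜] (p.nonHilbert.withTwo {n // ¬ p n ≠ 2}).Nakano 𝕜) := by
  classical
  refine ⟨(reindex (Equiv.sumCompl fun n => p n ≠ 2) ?_).symm⟩
  rintro (i | ⟨b, hb⟩)
  · rfl
  · exact not_not.1 hb

theorem nonempty_nonHilbertSum_equiv (B : Type u) :
    Nonempty ((p.nonHilbert.withTwo B).Nakano 𝕜 ≃ₗᵢ[𝕜]
      p.NonHilbertSum 𝕜 (lp (fun _ : B => 𝕜) 2)) := ⟨p.nonHilbert.withTwoEquiv B⟩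

/-- The elementary class consists of the infinite dimensional modular direct sums of `N_nh` with a
Hilbert space. -/
theorem mem_elementaryClass_iff (hp : Tendsto (fun n => p n) atTop (𝓝 2))
    (X : BanachSp.{0, u} 𝕜) :
    X ∈ BanachSp.elementaryClass.{u} 𝕜 (p.Nakano 𝕜) ↔ ¬ FiniteDimensional 𝕜 X ∧
      ∃ B : Type u, Nonempty (X ≃ₗᵢ[𝕜] (p.nonHilbert.withTwo B).Nakano 𝕜) := by
  have hq := tendsto_nonHilbert hp
  obtain ⟨e₀⟩ := p.nonempty_nakano_equiv (𝕜 := 𝕜)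
  have hN : ¬ FiniteDimensional 𝕜 (p.Nakano 𝕜) := fun h =>
    not_finite_iff_infinite.2 (inferInstanceAs (Infinite ℕ)) (finite_of_finiteDimensional h)
  constructor
  · rintro ⟨I, J, U, V, ⟨T⟩⟩
    obtain ⟨B', ⟨E⟩⟩ := exists_ultrapower_equiv hq e₀ V
    have hX : ¬ FiniteDimensional 𝕜 X := fun _ =>
      not_finiteDimensional_of_embedding (T.symm.toLinearIsometry.comp (diag 𝕜 (p.Nakano 𝕜) V)) hN
        finiteDimensional
    obtain ⟨H, _, _, _, ⟨F⟩⟩ := exists_ultraroot_equiv hq (fun i => i.2) hX (T.trans E)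
    obtain ⟨B, -, ⟨G⟩⟩ := p.nonHilbert.exists_withTwo_equiv (𝕜 := 𝕜) H
    exact ⟨hX, B, ⟨F.trans G⟩⟩
  · rintro ⟨hX, B, ⟨e⟩⟩
    have : Infinite X := by
      by_contra h
      have := not_infinite_iff_finite.1 h
      exact hX inferInstance
    -- The choice `κ = X` serves both spaces: `X` embeds in its power set by singletons, and the
    -- Nakano space of a sequence has at most continuum many points while `X` is infinite. Both
    -- ultrapowers then have `2 ^ |X|` exponents.
    let U : Ultrafilter (Finset X) := Ultrafilter.of atTop
    obtain ⟨B₁, ⟨E₁⟩⟩ := exists_ultrapower_equiv hq e U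
    obtain ⟨B₂, ⟨E₂⟩⟩ := exists_ultrapower_equiv hq e₀ U
    obtain ⟨g, hg⟩ := exists_injective_set (𝕜 := 𝕜) p X
    have h₁ := mk_eq_of_ultrapower hX (Set.singleton_injective (α := X)) E₁
    have h₂ := mk_eq_of_ultrapower hN hg E₂
    have hc : Cardinal.aleph0 < Cardinal.mk (Set X) := by
      rw [Cardinal.mk_set]
      exact (Cardinal.aleph0_le_mk X).trans_lt (Cardinal.cantor _)
    obtain ⟨E⟩ := nonempty_equiv_of_mk_eq (𝕜 := 𝕜) hc h₁ h₂
    exact ⟨_, _, U, U, ⟨(E₁.trans E).trans E₂.symm⟩⟩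

theorem exists_withTwo_iff (X : BanachSp.{0, u} 𝕜) :
    (∃ B : Type u, Nonempty (X ≃ₗᵢ[𝕜] (p.nonHilbert.withTwo B).Nakano 𝕜)) ↔
      ∃ (H : Type u) (_ : NormedAddCommGroup H) (_ : InnerProductSpace 𝕜 H),
        CompleteSpace H ∧ Nonempty (X ≃ₗᵢ[𝕜] p.NonHilbertSum 𝕜 H) := by
  constructor
  · rintro ⟨B, ⟨e⟩⟩
    obtain ⟨E⟩ := nonempty_nonHilbertSum_equiv (𝕜 := 𝕜) (p := p) B
    exact ⟨_, inferInstance, inferInstance, inferInstance, ⟨e.trans E⟩⟩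
  · rintro ⟨H, _, _, _, ⟨e⟩⟩
    obtain ⟨B, -, ⟨E⟩⟩ := p.nonHilbert.exists_withTwo_equiv (𝕜 := 𝕜) H
    exact ⟨B, ⟨e.trans E⟩⟩

theorem uncountablyCategorical (hp : Tendsto (fun n => p n) atTop (𝓝 2)) :
    BanachSp.UncountablyCategorical (BanachSp.elementaryClass.{u} 𝕜 (p.Nakano 𝕜)) := by
  have hq := tendsto_nonHilbert hp
  refine ⟨fun X hX I U => ?_, fun X Y hY I U => ?_, fun c hc => ⟨?_, ?_⟩⟩
  · obtain ⟨hfin, B, ⟨e⟩⟩ := (mem_elementaryClass_iff hp X).1 hX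
    obtain ⟨B', ⟨E⟩⟩ := exists_ultrapower_equiv hq e U
    exact (mem_elementaryClass_iff hp _).2
      ⟨not_finiteDimensional_of_embedding (diag 𝕜 X U) hfin, B ⊕ B', ⟨E⟩⟩
  · rintro ⟨T⟩
    obtain ⟨hfin, B, ⟨e⟩⟩ := (mem_elementaryClass_iff hp Y).1 hY
    have hX : ¬ FiniteDimensional 𝕜 X := fun _ =>
      not_finiteDimensional_of_embedding T.symm.toLinearIsometry hfin
        (finiteDimensional (𝕜 := 𝕜) (X := X) (U := U))
    have T' : BanachUltrapower 𝕜 X U ≃ₗᵢ[𝕜] (p.nonHilbert.withTwo B).Nakano 𝕜 := T.trans e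
    exact (mem_elementaryClass_iff hp X).2 ⟨hX, (exists_withTwo_iff X).2
      (exists_ultraroot_equiv hq (fun i => i.2) hX T')⟩
  · let X : BanachSp.{0, u} 𝕜 := ⟨(p.nonHilbert.withTwo c.out).Nakano 𝕜⟩
    have hB : Cardinal.mk ({n : ℕ // p n ≠ 2} ⊕ c.out) = c := by
      rw [Cardinal.mk_sum, Cardinal.lift_uzero, Cardinal.mk_out]
      refine Cardinal.add_eq_right hc.le (le_trans ?_ hc.le)
      simp
    have hinf : Infinite ({n : ℕ // p n ≠ 2} ⊕ c.out) := by
      rw [Cardinal.infinite_iff, hB]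
      exact hc.le
    refine ⟨X, (mem_elementaryClass_iff hp X).2
      ⟨fun h => not_finite_iff_infinite.2 hinf (finite_of_finiteDimensional h), _,
        ⟨LinearIsometryEquiv.refl 𝕜 _⟩⟩, ?_⟩
    obtain ⟨h1, h2⟩ := mk_eq_density (X := X) (LinearIsometryEquiv.refl 𝕜 _)
    rw [hB] at h1 h2
    rw [max_eq_left hc.le] at h2
    exact le_antisymm h2 h1
  · intro X hX Y hY hdX hdY
    have key : ∀ Z : BanachSp.{0, u} 𝕜, Z.density = c → ∀ B : Type u,
        (Z ≃ₗᵢ[𝕜] (p.nonHilbert.withTwo B).Nakano 𝕜) →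
        Cardinal.mk ({n : ℕ // p n ≠ 2} ⊕ B) = c := fun Z hZ B e => by
      obtain ⟨h1, h2⟩ := mk_eq_density e
      rw [hZ] at h1 h2
      rcases le_max_iff.1 h2 with h | h
      · exact le_antisymm h1 h
      · exact absurd h (not_le.2 hc)
    obtain ⟨-, B, ⟨e⟩⟩ := (mem_elementaryClass_iff hp X).1 hX
    obtain ⟨-, B', ⟨e'⟩⟩ := (mem_elementaryClass_iff hp Y).1 hY
    obtain ⟨E⟩ := nonempty_equiv_of_mk_eq (𝕜 := 𝕜) hc (key X hdX B e) (key Y hdY B' e')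
    exact ⟨(e.trans E).trans e'.symm⟩

end NakanoExponents

theorem corollary4p6 {𝕜 : Type} [RCLike 𝕜] (p : NakanoExponents ℕ)
    (hp : Tendsto (fun n => p n) atTop (𝓝 2)) :
    ({n : ℕ | p n ≠ 2}.Infinite →
      BanachSp.elementaryClass.{u} 𝕜 (p.Nakano 𝕜) =
        {X : BanachSp.{0, u} 𝕜 |
          ∃ (H : Type u) (_ : NormedAddCommGroup H) (_ : InnerProductSpace 𝕜 H),
            CompleteSpace H ∧ Nonempty (X ≃ₗᵢ[𝕜] p.NonHilbertSum 𝕜 H)}) ∧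
    ({n : ℕ | p n ≠ 2}.Finite →
      BanachSp.elementaryClass.{u} 𝕜 (p.Nakano 𝕜) =
        {X : BanachSp.{0, u} 𝕜 |
          ∃ (H : Type u) (_ : NormedAddCommGroup H) (_ : InnerProductSpace 𝕜 H),
            CompleteSpace H ∧ ¬ FiniteDimensional 𝕜 H ∧
              Nonempty (X ≃ₗᵢ[𝕜] p.NonHilbertSum 𝕜 H)}) ∧
    BanachSp.UncountablyCategorical (BanachSp.elementaryClass.{u} 𝕜 (p.Nakano 𝕜)) := by
  refine ⟨fun hinf => Set.ext fun X => ?_, fun hfin => Set.ext fun X => ?_,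
    NakanoExponents.uncountablyCategorical hp⟩
  · refine (NakanoExponents.mem_elementaryClass_iff hp X).trans
      ⟨fun h => (NakanoExponents.exists_withTwo_iff X).1 h.2, fun h => ⟨fun hX => ?_,
        (NakanoExponents.exists_withTwo_iff X).2 h⟩⟩
    -- `N_nh` is already infinite dimensional here, so no condition on `H` is needed.
    obtain ⟨B, ⟨e⟩⟩ := (NakanoExponents.exists_withTwo_iff X).2 h
    have hfd : FiniteDimensional 𝕜 ((p.nonHilbert.withTwo B).Nakano 𝕜) :=
      e.toLinearEquiv.finiteDimensional
    have h1 := NakanoExponents.finite_of_finiteDimensional hfd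
    have h2 : Finite {n : ℕ // p n ≠ 2} := Finite.sum_left B
    exact hinf (Set.finite_coe_iff.1 h2)
  -- Here `N_nh` is finite dimensional, so infinite dimensionality of `X` amounts to that of `H`.
  · have hJ : Finite {n : ℕ // p n ≠ 2} := hfin
    refine (NakanoExponents.mem_elementaryClass_iff hp X).trans ⟨fun h => ?_, ?_⟩
    · obtain ⟨H, i₁, i₂, hH, ⟨e⟩⟩ := (NakanoExponents.exists_withTwo_iff X).1 h.2
      refine ⟨H, i₁, i₂, hH, fun hfd => h.1 ?_, ⟨e⟩⟩
      have h1 : FiniteDimensional 𝕜 (p.nonHilbert.Nakano 𝕜) :=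
        NakanoExponents.finiteDimensional_of_finite
      have h2 : FiniteDimensional 𝕜 (p.NonHilbertSum 𝕜 H) :=
        inferInstanceAs (FiniteDimensional 𝕜 (p.nonHilbert.Nakano 𝕜 × H))
      exact e.symm.toLinearEquiv.finiteDimensional
    · rintro ⟨H, i₁, i₂, hH, hfd, ⟨e⟩⟩
      exact ⟨NakanoExponents.not_finiteDimensional_of_embedding
        (e.symm.toLinearIsometry.comp (ConvexModular.sumInr _ H)) hfd,
        (NakanoExponents.exists_withTwo_iff X).2 ⟨H, i₁, i₂, hH, ⟨e⟩⟩⟩
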